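/- Let $T$ be a Bienaymé–Galton–Watson tree in which each node has $0$, $1$ or $2$ children with probabilities $\tfrac14,\tfrac12,\tfrac14$ (the offspring law $\beta(1-\beta),\ \beta^2+(1-\beta)^2,\ \beta(1-\beta)$ with $\beta=\tfrac12$). Attach to the nodes $i$ i.i.d. random variables $X_i$, independent of the tree and distributed as a random variable $X$ with values in $\{-1,0,1,2,\dots\}$. For $n\ge 0$ truncate the tree at generation $n$ and define the runoff of its nodes recursively, starting from the leaves, by $$W_i^{(n)}=\Bigl(X_i+\sum_{j \text{ child of } i}W_j^{(n)}\Bigr)\vee 0 ;$$ the root runoff is $W=\lim_{n\to\infty}W_0^{(n)}$, where $0$ is the root (the sequence is non-decreasing). Let $F$ be the distribution function of $W$, so that $1-F(x)=P(W>x)$. Put $\alpha=P(X\ge 0)$ and assume $\alpha<1$. Put $\eta(t)=E\,t^{X+1}$, and assume that $\eta(t)$ is finite for all $t$ in a neighbourhood of $1$. Put $m=E X$ and $$h(t)=\frac{4}{1-\alpha}\,\frac{t\,(\eta(t)-t)}{(1-t)\,\eta(t)}\quad(t\ne 1),\qquad h(1)=\lim_{t\to1}h(t)=\frac{-4m}{1-\alpha}.$$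 Suppose that $h$ has a unique maximum $h_{\max}=h(t_0)$ on $[0,1]$, attained at the point $t_0>0$. Then: 1. (Subcritical case.) If $t_0=1$ and $\operatorname{Var}X<-m(1-m)$, then $E\,W^p<\infty$ for every $p>0$. 2. (Critical case.) If $t_0=1$ and $\operatorname{Var}X=-m(1-m)$, then, as $x\to\infty$, $$1-F(x)\sim\sqrt{-\frac{h''(1)(1-\alpha)}{8\pi}}\;x^{-3/2}.$$ 3. (Supercritical case.) If $t_0<1$, then, as $x\to\infty$, $$1-F(x)\sim\sqrt{\frac{(h_{\max}-h(1))(1-\alpha)}{\pi}}\;x^{-1/2}.$$ -/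

import Mathlib

open MeasureTheory ProbabilityTheory Filter Topology Set Asymptotics
open scoped ENNReal

namespace Runoff

/-! Nodes are words in `ℕ` (Ulam--Harris labels): `[]` is the root and `v ++ [i]` is the `i`-th
child of `v`. The node `v` of the tree has the children `v ++ [0], …, v ++ [Z v - 1]`. -/

/-- The runoff `(X v + ∑ (runoff of the children of v)) ∨ 0` from the node `v`, when the subtree
above `v` is truncated at height `n` (only descendants at most `n` generations from `v` are kept).
The value at `v = []` is the root runoff `W₀⁽ⁿ⁾` of the tree truncated at generation `n`. -/
def truncRunoff (Z : List ℕ → ℕ) (X : List ℕ → ℤ) : ℕ → List ℕ → ℤ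
  | 0, v => max (X v) 0
  | n + 1, v => max (X v + ∑ i ∈ Finset.range (Z v), truncRunoff Z X n (v ++ [i])) 0

/-- The root runoff `W = lim_n W₀⁽ⁿ⁾` with values in `[0, ∞]`. The sequence is non-decreasing, so
the limit is a supremum. -/
noncomputable def rootRunoff (Z : List ℕ → ℕ) (X : List ℕ → ℤ) : ℝ≥0∞ :=
  ⨆ n, ENNReal.ofReal (truncRunoff Z X n [] : ℝ)

theorem truncRunoff_nonneg (Z : List ℕ → ℕ) (X : List ℕ → ℤ) (n : ℕ) (v : List ℕ) :
    0 ≤ truncRunoff Z X n v := by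
  cases n <;> exact le_max_right _ _

theorem truncRunoff_le_succ (Z : List ℕ → ℕ) (X : List ℕ → ℤ) (n : ℕ) (v : List ℕ) :
    truncRunoff Z X n v ≤ truncRunoff Z X (n + 1) v := by
  induction n generalizing v with
  | zero =>
    have h : 0 ≤ ∑ i ∈ Finset.range (Z v), truncRunoff Z X 0 (v ++ [i]) :=
      Finset.sum_nonneg fun i _ => truncRunoff_nonneg Z X 0 _
    exact max_le_max (by linarith) le_rfl
  | succ n ih =>
    have h := Finset.sum_le_sum fun i (_ : i ∈ Finset.range (Z v)) => ih (v ++ [i])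
    exact max_le_max (by linarith) le_rfl

theorem tendsto_truncRunoff (Z : List ℕ → ℕ) (X : List ℕ → ℤ) :
    Tendsto (fun n => ENNReal.ofReal (truncRunoff Z X n [] : ℝ)) atTop (𝓝 (rootRunoff Z X)) := by
  refine tendsto_atTop_iSup (monotone_nat_of_le_succ fun n => ENNReal.ofReal_le_ofReal ?_)
  exact_mod_cast truncRunoff_le_succ Z X n []

section Model

variable {Ω : Type*} [MeasurableSpace Ω]

/-- The offspring numbers `Z v` and the point contributions `X v` of the nodes `v` form the
Bienaymé--Galton--Watson runoff model with parameter `β`: all the variables `Z v`, `X v` are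
independent, each `Z v` takes the values `0, 1, 2` with probabilities
`β(1-β)`, `β² + (1-β)²`, `β(1-β)`, and the `X v` are identically distributed. -/
structure IsBGWRunoffModel (μ : Measure Ω) (β : ℝ) (Z : List ℕ → Ω → ℕ)
    (X : List ℕ → Ω → ℤ) : Prop where
  measurable_offspring : ∀ v, Measurable (Z v)
  measurable_contribution : ∀ v, Measurable (X v)
  indep_nodes : iIndepFun (fun v ω => (Z v ω, X v ω)) μ
  indep_at_node : ∀ v, IndepFun (Z v) (X v) μ
  offspring_zero : ∀ v, μ.real {ω | Z v ω = 0} = β * (1 - β)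
  offspring_one : ∀ v, μ.real {ω | Z v ω = 1} = β ^ 2 + (1 - β) ^ 2
  offspring_two : ∀ v, μ.real {ω | Z v ω = 2} = β * (1 - β)
  identDistrib : ∀ v, IdentDistrib (X v) (X []) μ μ

/-- `α = P(X ≥ 0)`. -/
noncomputable def probNonneg (μ : Measure Ω) (X : Ω → ℤ) : ℝ := μ.real {ω | 0 ≤ X ω}

/-- `m = E X`. -/
noncomputable def mean (μ : Measure Ω) (X : Ω → ℤ) : ℝ := ∫ ω, (X ω : ℝ) ∂μ

/-- `η(t) = E t^(X+1)`, the probability generating function of `X + 1` (with `0 ^ 0 = 1`). -/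
noncomputable def eta (μ : Measure Ω) (X : Ω → ℤ) (t : ℝ) : ℝ := ∫ ω, t ^ (X ω + 1) ∂μ

/-- `h(t) = 4/(1-α) · t(η(t) - t) / ((1-t) η(t))` for `t ≠ 1`, extended to `t = 1` by its limit
`h(1) = -4m/(1-α)`. -/
noncomputable def h (μ : Measure Ω) (X : Ω → ℤ) (t : ℝ) : ℝ :=
  if t = 1 then -4 * mean μ X / (1 - probNonneg μ X)
  else 4 / (1 - probNonneg μ X) * (t * (eta μ X t - t) / ((1 - t) * eta μ X t))

/-- The root runoff as a random variable. -/
noncomputable def W (Z : List ℕ → Ω → ℕ) (X : List ℕ → Ω → ℤ) (ω : Ω) : ℝ≥0∞ :=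
  rootRunoff (fun v => Z v ω) (fun v => X v ω)

/-- The tail `P(W > x) = 1 - F(x)` of the root runoff, for `x ≥ 0`. -/
noncomputable def tail (μ : Measure Ω) (Z : List ℕ → Ω → ℕ) (X : List ℕ → Ω → ℤ) (x : ℝ) : ℝ :=
  μ.real {ω | ENNReal.ofReal x < W Z X ω}

end Model

end Runoff

set_option linter.unusedSectionVars false

/-! Write `G` for `runoffGF`. Since it is defined through the tail, it is the generating function of
`W` restricted to `W < ∞`, so finiteness of `W` need not be known in advance. At `β = 1/2` the
offspring generating function is the perfect square `((1+s)/2)²`. Decomposing at the root gives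
`functional_equation`, a quadratic equation for `G(t)` whose only unknown parameter is `c = 1 +
G(0)`. Completing the square (`signedRoot_sq`), the quantity `R(t) = η(t)(1+G(t))/2 - t` satisfies
`R² = (1-t)·(1-α)η/4·(c² - h)`.

The constant `c` is found by a sign argument. The left side is a square, so `c² ≥ h` on `(0,1)`, and
at `1` by continuity. If `c² > h_max`, then `R` has no zero on `(0,1)`, hence has constant sign. It
is positive at some point (`exists_signedRoot_pos`), but it cannot stay positive up to `1`: `G ≤ 1`
gives `R ≤ η - t = O(1-t)`, whereas `|R|` would be of order `√(1-t)`
(`not_eventually_signedRoot_pos`). Hence `c² = h_max` (`sq_one_add_runoffGF_zero`), and the same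
argument fixes the sign of `R` in each case.

The behaviour of `R` at `1` decides the tail. If `t₀ < 1`, then `R` is negative near `1` and of
order `√(1-t)`. If `t₀ = 1`, then `R > 0` and `h(1) - h` vanishes at `1`: to first order in the
subcritical case, where `R` is `1-t` times an analytic function and `G` continues analytically
through `1`; to second order in the critical case, where `R` is of order `(1-t)^(3/2)`.

Analytic continuation gives all moments (`lintegral_pow_lt_top_of_mgf_eqOn`). In the supercritical
case Karamata's theorem (`tendsto_coeff_of_antitone`) applies to the tail itself. In the critical
case it applies to the tail sums, from which the monotone density theorem
(`tendsto_of_tendsto_tail_sum`) recovers the tail. -/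

namespace Runoff

/-! ### Karamata's Tauberian theorem for monotone coefficients -/

section Tauberian

/-- The weighted Abel mean `(1-t)^ρ ∑ a k t^k φ(t^k)`. -/
noncomputable def abelMean (a : ℕ → ℝ) (ρ t : ℝ) (φ : ℝ → ℝ) : ℝ :=
  (1 - t) ^ ρ * ∑' k, a k * t ^ k * φ (t ^ k)

/-- The expectation of `φ(e^{-x})` under the Gamma distribution with shape `ρ` and rate `1`. -/
noncomputable def gammaMean (ρ : ℝ) (φ : ℝ → ℝ) : ℝ :=
  (Real.Gamma ρ)⁻¹ * ∫ x in Ioi (0 : ℝ), x ^ (ρ - 1) * Real.exp (-x) * φ (Real.exp (-x))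

variable {a : ℕ → ℝ} {ρ A t : ℝ} {φ ψ : ℝ → ℝ}

theorem exists_abs_le_of_continuousOn (hφ : ContinuousOn φ (Icc 0 1)) :
    ∃ C, 0 ≤ C ∧ ∀ x ∈ Icc (0 : ℝ) 1, |φ x| ≤ C := by
  obtain ⟨C, hC⟩ := isCompact_Icc.exists_bound_of_continuousOn hφ
  exact ⟨C, (norm_nonneg _).trans (hC 0 (by simp)), hC⟩

theorem pow_mem_unitInterval (ht : t ∈ Ioo (0 : ℝ) 1) (k : ℕ) : t ^ k ∈ Icc (0 : ℝ) 1 :=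
  ⟨pow_nonneg ht.1.le k, pow_le_one₀ ht.1.le ht.2.le⟩

theorem summable_abelMean (ha : ∀ k, 0 ≤ a k) (hs : Summable fun k => a k * t ^ k)
    (ht : t ∈ Ioo (0 : ℝ) 1) (hφ : ContinuousOn φ (Icc 0 1)) :
    Summable fun k => a k * t ^ k * φ (t ^ k) := by
  obtain ⟨C, -, hC⟩ := exists_abs_le_of_continuousOn hφ
  refine (hs.mul_right C).of_norm_bounded fun k => ?_
  have h0 : 0 ≤ a k * t ^ k := mul_nonneg (ha k) (pow_nonneg ht.1.le k)
  rw [norm_mul, Real.norm_of_nonneg h0]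
  exact mul_le_mul_of_nonneg_left (hC _ (pow_mem_unitInterval ht k)) h0

theorem abelMean_add (ha : ∀ k, 0 ≤ a k) (hs : Summable fun k => a k * t ^ k)
    (ht : t ∈ Ioo (0 : ℝ) 1) (hφ : ContinuousOn φ (Icc 0 1)) (hψ : ContinuousOn ψ (Icc 0 1)) :
    abelMean a ρ t (fun x => φ x + ψ x) = abelMean a ρ t φ + abelMean a ρ t ψ := by
  simp only [abelMean, mul_add]
  rw [(summable_abelMean ha hs ht hφ).tsum_add (summable_abelMean ha hs ht hψ), mul_add]

theorem abelMean_const_mul (c : ℝ) :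
    abelMean a ρ t (fun x => c * φ x) = c * abelMean a ρ t φ := by
  simp only [abelMean, mul_left_comm _ c, tsum_mul_left]

theorem abelMean_mono (ha : ∀ k, 0 ≤ a k) (hs : Summable fun k => a k * t ^ k)
    (ht : t ∈ Ioo (0 : ℝ) 1) (hφ : ContinuousOn φ (Icc 0 1)) (hψ : ContinuousOn ψ (Icc 0 1))
    (hle : ∀ x ∈ Icc (0 : ℝ) 1, φ x ≤ ψ x) : abelMean a ρ t φ ≤ abelMean a ρ t ψ := by
  refine mul_le_mul_of_nonneg_left ?_ (Real.rpow_nonneg (by linarith [ht.2]) _)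
  exact (summable_abelMean ha hs ht hφ).tsum_le_tsum (fun k => mul_le_mul_of_nonneg_left
    (hle _ (pow_mem_unitInterval ht k)) (mul_nonneg (ha k) (pow_nonneg ht.1.le k)))
    (summable_abelMean ha hs ht hψ)

theorem exp_neg_mem_unitInterval {x : ℝ} (hx : x ∈ Ioi (0 : ℝ)) : Real.exp (-x) ∈ Icc (0 : ℝ) 1 :=
  ⟨(Real.exp_pos _).le, Real.exp_le_one_iff.2 (by simpa using (mem_Ioi.1 hx).le)⟩

theorem integrableOn_gammaMean (hρ : 0 < ρ) (hφ : ContinuousOn φ (Icc 0 1)) :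
    IntegrableOn (fun x => x ^ (ρ - 1) * Real.exp (-x) * φ (Real.exp (-x))) (Ioi 0) := by
  obtain ⟨C, -, hC⟩ := exists_abs_le_of_continuousOn hφ
  have h1 : IntegrableOn (fun x : ℝ => x ^ (ρ - 1) * Real.exp (-x)) (Ioi 0) := by
    simpa [mul_comm] using Real.GammaIntegral_convergent hρ
  have hc : ContinuousOn (fun x : ℝ => φ (Real.exp (-x))) (Ioi 0) :=
    hφ.comp (by fun_prop) fun x hx => exp_neg_mem_unitInterval hx
  refine Integrable.mul_bdd (c := C) h1 (hc.aestronglyMeasurable measurableSet_Ioi) ?_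
  exact (ae_restrict_mem measurableSet_Ioi).mono fun x hx => hC _ (exp_neg_mem_unitInterval hx)

theorem gammaMean_add (hρ : 0 < ρ) (hφ : ContinuousOn φ (Icc 0 1))
    (hψ : ContinuousOn ψ (Icc 0 1)) :
    gammaMean ρ (fun x => φ x + ψ x) = gammaMean ρ φ + gammaMean ρ ψ := by
  simp only [gammaMean, mul_add]
  rw [integral_add (integrableOn_gammaMean hρ hφ) (integrableOn_gammaMean hρ hψ), mul_add]

theorem gammaMean_const_mul (c : ℝ) :
    gammaMean ρ (fun x => c * φ x) = c * gammaMean ρ φ := by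
  simp only [gammaMean, mul_left_comm _ c, integral_const_mul]

theorem gammaMean_mono (hρ : 0 < ρ) (hφ : ContinuousOn φ (Icc 0 1))
    (hψ : ContinuousOn ψ (Icc 0 1)) (hle : ∀ x ∈ Icc (0 : ℝ) 1, φ x ≤ ψ x) :
    gammaMean ρ φ ≤ gammaMean ρ ψ := by
  refine mul_le_mul_of_nonneg_left ?_ (inv_nonneg.2 (Real.Gamma_pos_of_pos hρ).le)
  refine setIntegral_mono_on (integrableOn_gammaMean hρ hφ) (integrableOn_gammaMean hρ hψ)
    measurableSet_Ioi fun x hx => mul_le_mul_of_nonneg_left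
      (hle _ (exp_neg_mem_unitInterval hx)) ?_
  exact mul_nonneg (Real.rpow_nonneg (mem_Ioi.1 hx).le _) (Real.exp_pos _).le

theorem gammaMean_pow (hρ : 0 < ρ) (j : ℕ) :
    gammaMean ρ (fun x => x ^ j) = (1 / ((j : ℝ) + 1)) ^ ρ := by
  have hj : (0 : ℝ) < j + 1 := by positivity
  have h : ∀ x : ℝ, x ^ (ρ - 1) * Real.exp (-x) * Real.exp (-x) ^ j
      = x ^ (ρ - 1) * Real.exp (-(((j : ℝ) + 1) * x)) := fun x => by
    rw [mul_assoc, ← Real.exp_nat_mul, ← Real.exp_add]; ring_nf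
  simp only [gammaMean, h]
  rw [Real.integral_rpow_mul_exp_neg_mul_Ioi hρ hj, mul_comm, mul_assoc,
    mul_inv_cancel₀ (Real.Gamma_pos_of_pos hρ).ne', mul_one]

theorem tendsto_pow_nhdsLT_one (j : ℕ) :
    Tendsto (fun t : ℝ => t ^ (j + 1)) (𝓝[<] 1) (𝓝[<] 1) := by
  refine tendsto_nhdsWithin_iff.2 ⟨?_, ?_⟩
  · have : Tendsto (fun t : ℝ => t ^ (j + 1)) (𝓝 1) (𝓝 (1 ^ (j + 1))) :=
      (continuous_pow (j + 1)).tendsto 1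
    rw [one_pow] at this
    exact this.mono_left nhdsWithin_le_nhds
  · filter_upwards [Ioo_mem_nhdsLT (zero_lt_one' ℝ)] with t ht
    exact pow_lt_one₀ ht.1.le ht.2 j.succ_ne_zero

theorem tendsto_one_sub_div_one_sub_pow (j : ℕ) :
    Tendsto (fun t : ℝ => (1 - t) / (1 - t ^ (j + 1))) (𝓝[<] 1) (𝓝 (1 / ((j : ℝ) + 1))) := by
  have h1 : Tendsto (fun t : ℝ => 1 / ∑ i ∈ Finset.range (j + 1), t ^ i) (𝓝[<] 1)
      (𝓝 (1 / ((j : ℝ) + 1))) := by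
    have hc : Continuous fun t : ℝ => ∑ i ∈ Finset.range (j + 1), t ^ i := by fun_prop
    have := (hc.tendsto 1).mono_left (nhdsWithin_le_nhds (s := Iio 1))
    simp only [one_pow, Finset.sum_const, Finset.card_range, nsmul_eq_mul, mul_one,
      Nat.cast_add, Nat.cast_one] at this
    exact tendsto_const_nhds.div this (by positivity)
  refine h1.congr' ?_
  filter_upwards [Ioo_mem_nhdsLT (zero_lt_one' ℝ)] with t ht
  have h2 : 0 < ∑ i ∈ Finset.range (j + 1), t ^ i :=
    Finset.sum_pos (fun i _ => pow_pos ht.1 i) (by simp)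
  have h3 : (0 : ℝ) < 1 - t := by linarith [ht.2]
  rw [← mul_neg_geom_sum t (j + 1)]
  field_simp

/-- Because `t^k (t^k)^j = (t^(j+1))^k`, this mean is the plain Abel sum at `t^(j+1)`, rescaled by
`((1-t)/(1-t^(j+1)))^ρ`. That factor tends to `(j+1)^(-ρ)`, which is the Gamma mean of `x^j`. -/
theorem tendsto_abelMean_pow (hρ : 0 < ρ)
    (hA : Tendsto (fun t => (1 - t) ^ ρ * ∑' k, a k * t ^ k) (𝓝[<] 1) (𝓝 A)) (j : ℕ) :
    Tendsto (fun t => abelMean a ρ t fun x => x ^ j) (𝓝[<] 1)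
      (𝓝 (A * gammaMean ρ fun x => x ^ j)) := by
  have h1 := (tendsto_one_sub_div_one_sub_pow j).rpow_const (p := ρ) (Or.inr hρ.le)
  have h2 := (hA.comp (tendsto_pow_nhdsLT_one j)).mul h1
  rw [gammaMean_pow hρ]
  refine h2.congr' ?_
  filter_upwards [Ioo_mem_nhdsLT (zero_lt_one' ℝ)] with t ht
  have h3 : 0 < 1 - t ^ (j + 1) := sub_pos.2 (pow_lt_one₀ ht.1.le ht.2 j.succ_ne_zero)
  have h4 : 0 ≤ 1 - t := by linarith [ht.2]
  have h5 : ∀ k, t ^ k * (t ^ k) ^ j = (t ^ (j + 1)) ^ k := fun k => by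
    rw [← pow_mul, ← pow_mul, ← pow_add]; ring_nf
  simp only [Function.comp, abelMean, mul_assoc, h5]
  rw [Real.div_rpow h4 h3.le]
  have := (Real.rpow_pos_of_pos h3 ρ).ne'
  field_simp

theorem tendsto_abelMean_polynomial (hρ : 0 < ρ) (ha : ∀ k, 0 ≤ a k)
    (hs : ∀ t ∈ Ioo (0 : ℝ) 1, Summable fun k => a k * t ^ k)
    (hA : Tendsto (fun t => (1 - t) ^ ρ * ∑' k, a k * t ^ k) (𝓝[<] 1) (𝓝 A))
    (p : Polynomial ℝ) :
    Tendsto (fun t => abelMean a ρ t fun x => p.eval x) (𝓝[<] 1)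
      (𝓝 (A * gammaMean ρ fun x => p.eval x)) := by
  induction p using Polynomial.induction_on' with
  | add p q hp hq =>
    simp only [Polynomial.eval_add]
    rw [gammaMean_add hρ p.continuousOn q.continuousOn, mul_add]
    refine (hp.add hq).congr' ?_
    filter_upwards [Ioo_mem_nhdsLT (zero_lt_one' ℝ)] with t ht
    exact (abelMean_add ha (hs t ht) ht p.continuousOn q.continuousOn).symm
  | monomial n c =>
    simp only [Polynomial.eval_monomial, abelMean_const_mul, gammaMean_const_mul,
      mul_left_comm A c]
    exact (tendsto_abelMean_pow hρ hA n).const_mul c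

/-- Weierstrass approximation: both functionals are monotone in `φ`, and their values on constants
are controlled, so a uniform error in `φ` costs only a multiple of itself. -/
theorem tendsto_abelMean (hρ : 0 < ρ) (ha : ∀ k, 0 ≤ a k)
    (hs : ∀ t ∈ Ioo (0 : ℝ) 1, Summable fun k => a k * t ^ k)
    (hA : Tendsto (fun t => (1 - t) ^ ρ * ∑' k, a k * t ^ k) (𝓝[<] 1) (𝓝 A))
    (hφ : ContinuousOn φ (Icc 0 1)) :
    Tendsto (fun t => abelMean a ρ t φ) (𝓝[<] 1) (𝓝 (A * gammaMean ρ φ)) := by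
  have hone := tendsto_abelMean_pow hρ hA 0
  have hg1 : gammaMean ρ (fun _ => (1 : ℝ)) = 1 := by
    simpa using gammaMean_pow hρ 0
  simp only [pow_zero, hg1, mul_one] at hone
  have hA0 : 0 ≤ A := by
    refine ge_of_tendsto hone ?_
    filter_upwards [Ioo_mem_nhdsLT (zero_lt_one' ℝ)] with t ht
    refine mul_nonneg (Real.rpow_nonneg (by linarith [ht.2]) _) (tsum_nonneg fun k => ?_)
    exact mul_nonneg (mul_nonneg (ha k) (pow_nonneg ht.1.le k)) zero_le_one
  rw [Metric.tendsto_nhds]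
  intro ε hε
  -- Error budget: `δ(A+1)` for replacing `φ` by the polynomial in the Abel mean, `δA` in the Gamma
  -- mean, and `δ` for the polynomial limit.
  obtain ⟨δ, hδ, hδε⟩ : ∃ δ > 0, δ * (2 * A + 1) + δ < ε :=
    ⟨ε / (2 * (2 * A + 2)), by positivity, by
      rw [← mul_add_one, div_mul_eq_mul_div, div_lt_iff₀ (by positivity)]; nlinarith⟩
  obtain ⟨p, hp⟩ := exists_polynomial_near_of_continuousOn 0 1 φ hφ δ hδ
  have hpc : ContinuousOn (fun x => p.eval x) (Icc 0 1) := p.continuousOn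
  have hcc : ContinuousOn (fun _ : ℝ => δ * (1 : ℝ)) (Icc 0 1) := continuousOn_const
  have hnc : ContinuousOn (fun _ : ℝ => -δ * (1 : ℝ)) (Icc 0 1) := continuousOn_const
  have hu : ∀ x ∈ Icc (0 : ℝ) 1, φ x ≤ p.eval x + δ * 1 := fun x hx => by
    linarith [(abs_lt.1 (hp x hx)).1]
  have hl : ∀ x ∈ Icc (0 : ℝ) 1, p.eval x + -δ * 1 ≤ φ x := fun x hx => by
    linarith [(abs_lt.1 (hp x hx)).2]
  have hgu := gammaMean_mono (ψ := fun x => p.eval x + δ * 1) hρ hφ (hpc.add hcc) hu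
  have hgl := gammaMean_mono (φ := fun x => p.eval x + -δ * 1) hρ (hpc.add hnc) hφ hl
  rw [gammaMean_add hρ hpc hcc, gammaMean_const_mul, hg1] at hgu
  rw [gammaMean_add hρ hpc hnc, gammaMean_const_mul, hg1] at hgl
  filter_upwards [Ioo_mem_nhdsLT (zero_lt_one' ℝ),
    Metric.tendsto_nhds.1 (tendsto_abelMean_polynomial hρ ha hs hA p) δ hδ,
    hone.eventually_lt_const (lt_add_one A)] with t ht hpt h1t
  have hau := abelMean_mono (ρ := ρ) (ψ := fun x => p.eval x + δ * 1) ha (hs t ht) ht hφ (hpc.add hcc) hu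
  have hal := abelMean_mono (ρ := ρ) (φ := fun x => p.eval x + -δ * 1) ha (hs t ht) ht (hpc.add hnc) hφ hl
  rw [abelMean_add ha (hs t ht) ht hpc hcc, abelMean_const_mul] at hau
  rw [abelMean_add ha (hs t ht) ht hpc hnc, abelMean_const_mul] at hal
  rw [Real.dist_eq, abs_lt] at hpt ⊢
  have e1 := mul_le_mul_of_nonneg_left hgu hA0
  have e2 := mul_le_mul_of_nonneg_left hgl hA0
  have e3 := mul_lt_mul_of_pos_left h1t hδ
  constructor <;> nlinarith

/-- A continuous bump supported in `[p, q]`. -/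
noncomputable def bump (p q s : ℝ) : ℝ := max 0 ((s - p) * (q - s))

theorem continuous_bump (p q : ℝ) : Continuous (bump p q) := by unfold bump; fun_prop

theorem bump_nonneg (p q s : ℝ) : 0 ≤ bump p q s := le_max_left _ _

theorem bump_eq_zero {p q s : ℝ} (hpq : p < q) (hs : s ∉ Icc p q) : bump p q s = 0 := by
  rw [bump, max_eq_left]
  rw [mem_Icc, not_and_or, not_le, not_le] at hs
  rcases hs with hs | hs <;> nlinarith

theorem gammaMean_one_bump_pos {x₁ x₂ : ℝ} (h₁ : 0 ≤ x₁) (h₁₂ : x₁ < x₂) :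
    0 < gammaMean 1 (bump (Real.exp (-x₂)) (Real.exp (-x₁))) := by
  have hi := integrableOn_gammaMean (φ := bump (Real.exp (-x₂)) (Real.exp (-x₁))) one_pos
    (continuous_bump _ _).continuousOn
  refine mul_pos (by simp) ?_
  rw [setIntegral_pos_iff_support_of_nonneg_ae _ hi]
  · refine lt_of_lt_of_le ?_ (measure_mono (s := Ioo x₁ x₂) fun x hx => ⟨?_, h₁.trans_lt hx.1⟩)
    · simpa using h₁₂
    · have : 0 < bump (Real.exp (-x₂)) (Real.exp (-x₁)) (Real.exp (-x)) :=
        lt_max_of_lt_right (mul_pos (sub_pos.2 (Real.exp_lt_exp.2 (by linarith [hx.2])))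
          (sub_pos.2 (Real.exp_lt_exp.2 (by linarith [hx.1]))))
      simp [this.ne', (Real.exp_pos _).ne']
  · exact (ae_restrict_mem measurableSet_Ioi).mono fun x hx => mul_nonneg
      (mul_nonneg (Real.rpow_nonneg (mem_Ioi.1 hx).le _) (Real.exp_pos _).le) (bump_nonneg _ _ _)

/-- The bump confines `x` to `[x₁, x₂]`, where the decreasing factor `x^(ρ-1)` lies between its
endpoint values. Squeezing the window thus replaces any evaluation of the integral. -/
theorem gammaMean_bump_bounds {x₁ x₂ : ℝ} (h₁ : 0 < x₁) (h₁₂ : x₁ < x₂) (hρ : 0 < ρ)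
    (hρ1 : ρ ≤ 1) :
    (Real.Gamma ρ)⁻¹ * x₂ ^ (ρ - 1) * gammaMean 1 (bump (Real.exp (-x₂)) (Real.exp (-x₁)))
        ≤ gammaMean ρ (bump (Real.exp (-x₂)) (Real.exp (-x₁))) ∧
      gammaMean ρ (bump (Real.exp (-x₂)) (Real.exp (-x₁))) ≤
        (Real.Gamma ρ)⁻¹ * x₁ ^ (ρ - 1) *
          gammaMean 1 (bump (Real.exp (-x₂)) (Real.exp (-x₁))) := by
  set φ := bump (Real.exp (-x₂)) (Real.exp (-x₁)) with hφ
  have hc : ContinuousOn φ (Icc 0 1) := (continuous_bump _ _).continuousOn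
  have hG := inv_nonneg.2 (Real.Gamma_pos_of_pos hρ).le
  have key : ∀ x ∈ Ioi (0 : ℝ), φ (Real.exp (-x)) ≠ 0 → x₁ ≤ x ∧ x ≤ x₂ := fun x _ hne => by
    by_contra hcon
    refine hne (bump_eq_zero (Real.exp_lt_exp.2 (by linarith)) fun hmem => hcon ?_)
    rw [mem_Icc, Real.exp_le_exp, Real.exp_le_exp] at hmem
    constructor <;> linarith [hmem.1, hmem.2]
  have hb : ∀ x, 0 ≤ Real.exp (-x) * φ (Real.exp (-x)) := fun x =>
    mul_nonneg (Real.exp_pos _).le (bump_nonneg _ _ _)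
  have hi1 := integrableOn_gammaMean one_pos hc
  have hir := integrableOn_gammaMean hρ hc
  simp only [gammaMean, Real.Gamma_one, inv_one, one_mul, mul_assoc, sub_self, Real.rpow_zero]
    at hi1 hir ⊢
  have hpt : ∀ x ∈ Ioi (0 : ℝ),
      x₂ ^ (ρ - 1) * (Real.exp (-x) * φ (Real.exp (-x)))
        ≤ x ^ (ρ - 1) * (Real.exp (-x) * φ (Real.exp (-x))) ∧
      x ^ (ρ - 1) * (Real.exp (-x) * φ (Real.exp (-x)))
        ≤ x₁ ^ (ρ - 1) * (Real.exp (-x) * φ (Real.exp (-x))) := fun x hx => by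
    by_cases h0 : φ (Real.exp (-x)) = 0
    · simp [h0]
    · exact ⟨mul_le_mul_of_nonneg_right
        (Real.rpow_le_rpow_of_nonpos hx (key x hx h0).2 (by linarith)) (hb x),
        mul_le_mul_of_nonneg_right
        (Real.rpow_le_rpow_of_nonpos h₁ (key x hx h0).1 (by linarith)) (hb x)⟩
  constructor
  · refine mul_le_mul_of_nonneg_left ?_ hG
    rw [← integral_const_mul]
    exact setIntegral_mono_on (hi1.const_mul _) hir measurableSet_Ioi fun x hx => (hpt x hx).1
  · refine mul_le_mul_of_nonneg_left ?_ hG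
    rw [← integral_const_mul]
    exact setIntegral_mono_on hir (hi1.const_mul _) measurableSet_Ioi fun x hx => (hpt x hx).2

theorem tendsto_exp_neg_inv_nat :
    Tendsto (fun n : ℕ => Real.exp (-(1 / (n : ℝ)))) atTop (𝓝[<] 1) := by
  refine tendsto_nhdsWithin_iff.2 ⟨?_, ?_⟩
  · have h : Tendsto (fun n : ℕ => -(1 / (n : ℝ))) atTop (𝓝 0) := by
      simpa using (tendsto_one_div_atTop_nhds_zero_nat (𝕜 := ℝ)).neg
    simpa [Function.comp_def] using (Real.continuous_exp.tendsto 0).comp h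
  · filter_upwards [eventually_gt_atTop 0] with n hn
    have : (0 : ℝ) < n := Nat.cast_pos.2 hn
    exact Real.exp_lt_one_iff.2 (by simpa using this)

theorem tendsto_mul_one_sub_exp_neg_inv_nat :
    Tendsto (fun n : ℕ => (n : ℝ) * (1 - Real.exp (-(1 / (n : ℝ))))) atTop (𝓝 1) := by
  have hd : HasDerivAt (fun x : ℝ => 1 - Real.exp (-x)) 1 0 := by
    have := ((hasDerivAt_neg (0 : ℝ)).exp).const_sub 1
    simpa using this
  have h := hd.tendsto_slope_zero_right
  have h2 : Tendsto (fun n : ℕ => 1 / (n : ℝ)) atTop (𝓝[>] 0) :=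
    tendsto_nhdsWithin_iff.2 ⟨tendsto_one_div_atTop_nhds_zero_nat, by
      filter_upwards [eventually_gt_atTop 0] with n hn
      have : (0 : ℝ) < n := Nat.cast_pos.2 hn
      simpa using this⟩
  refine (h.comp h2).congr fun n => ?_
  simp

theorem tendsto_abelMean_one (hφ : ContinuousOn φ (Icc 0 1)) :
    Tendsto (fun t => abelMean (fun _ => 1) 1 t φ) (𝓝[<] 1) (𝓝 (gammaMean 1 φ)) := by
  have hs : ∀ t ∈ Ioo (0 : ℝ) 1, Summable fun k : ℕ => (fun _ : ℕ => (1 : ℝ)) k * t ^ k :=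
    fun t ht => by simpa using summable_geometric_of_lt_one ht.1.le ht.2
  have := tendsto_abelMean (A := 1) one_pos (fun _ => zero_le_one) hs ?_ hφ
  · simpa using this
  · refine tendsto_const_nhds.congr' ?_
    filter_upwards [Ioo_mem_nhdsLT (zero_lt_one' ℝ)] with t ht
    have : (1 - t) ≠ 0 := by linarith [ht.2]
    simp [tsum_geometric_of_lt_one ht.1.le ht.2, this]

/-- Comparing with the constant sequence `1` lets the unknown sum of bump values cancel in a
quotient. The factor `(1-t)^(ρ-1)` accounts for the different normalising exponents. -/
theorem abelMean_le_of_support (ha : ∀ k, 0 ≤ a k) (ht : t ∈ Ioo (0 : ℝ) 1)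
    (hs : Summable fun k => a k * t ^ k) (hφ : ContinuousOn φ (Icc 0 1)) (hφ0 : ∀ x, 0 ≤ φ x)
    {b : ℝ} (hb : ∀ k, φ (t ^ k) ≠ 0 → a k ≤ b) :
    abelMean a ρ t φ ≤ b * (1 - t) ^ (ρ - 1) * abelMean (fun _ => 1) 1 t φ := by
  have h1 : 0 < 1 - t := by linarith [ht.2]
  have hs1 : Summable fun k : ℕ => (fun _ : ℕ => (1 : ℝ)) k * t ^ k := by
    simpa using summable_geometric_of_lt_one ht.1.le ht.2
  have := (summable_abelMean ha hs ht hφ).tsum_le_tsum (fun k => ?_)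
    ((summable_abelMean (fun _ => zero_le_one) hs1 ht hφ).mul_left b)
  · calc abelMean a ρ t φ ≤ (1 - t) ^ ρ * (b * ∑' k : ℕ, 1 * t ^ k * φ (t ^ k)) := by
          rw [← tsum_mul_left]; exact mul_le_mul_of_nonneg_left this (Real.rpow_nonneg h1.le _)
      _ = _ := by
          rw [abelMean, Real.rpow_sub_one h1.ne', Real.rpow_one]; field_simp
  · by_cases h0 : φ (t ^ k) = 0
    · simp [h0]
    · rw [one_mul, mul_assoc]
      exact mul_le_mul_of_nonneg_right (hb k h0) (mul_nonneg (pow_nonneg ht.1.le k) (hφ0 _))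

theorem le_abelMean_of_support (ha : ∀ k, 0 ≤ a k) (ht : t ∈ Ioo (0 : ℝ) 1)
    (hs : Summable fun k => a k * t ^ k) (hφ : ContinuousOn φ (Icc 0 1)) (hφ0 : ∀ x, 0 ≤ φ x)
    {b : ℝ} (hb : ∀ k, φ (t ^ k) ≠ 0 → b ≤ a k) :
    b * (1 - t) ^ (ρ - 1) * abelMean (fun _ => 1) 1 t φ ≤ abelMean a ρ t φ := by
  have h1 : 0 < 1 - t := by linarith [ht.2]
  have hs1 : Summable fun k : ℕ => (fun _ : ℕ => (1 : ℝ)) k * t ^ k := by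
    simpa using summable_geometric_of_lt_one ht.1.le ht.2
  have := ((summable_abelMean (fun _ => zero_le_one) hs1 ht hφ).mul_left b).tsum_le_tsum
    (fun k => ?_) (summable_abelMean ha hs ht hφ)
  · calc _ = (1 - t) ^ ρ * (b * ∑' k : ℕ, 1 * t ^ k * φ (t ^ k)) := by
          rw [abelMean, Real.rpow_sub_one h1.ne', Real.rpow_one]; field_simp
      _ ≤ _ := by
          rw [← tsum_mul_left]; exact mul_le_mul_of_nonneg_left this (Real.rpow_nonneg h1.le _)
  · by_cases h0 : φ (t ^ k) = 0
    · simp [h0]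
    · rw [one_mul, mul_assoc]
      exact mul_le_mul_of_nonneg_right (hb k h0) (mul_nonneg (pow_nonneg ht.1.le k) (hφ0 _))

/-- Karamata's Tauberian theorem for a power series with non-increasing coefficients. -/
theorem tendsto_coeff_of_antitone (hρ : 0 < ρ) (hρ1 : ρ ≤ 1) (ha : ∀ k, 0 ≤ a k)
    (hanti : Antitone a) (hs : ∀ t ∈ Ioo (0 : ℝ) 1, Summable fun k => a k * t ^ k)
    (hA : Tendsto (fun t => (1 - t) ^ ρ * ∑' k, a k * t ^ k) (𝓝[<] 1) (𝓝 A)) :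
    Tendsto (fun n : ℕ => a n * (n : ℝ) ^ (1 - ρ)) atTop (𝓝 (A * (Real.Gamma ρ)⁻¹)) := by
  have hA0 : 0 ≤ A := by
    refine ge_of_tendsto hA ?_
    filter_upwards [Ioo_mem_nhdsLT (zero_lt_one' ℝ)] with t ht
    exact mul_nonneg (Real.rpow_nonneg (by linarith [ht.2]) _)
      (tsum_nonneg fun k => mul_nonneg (ha k) (pow_nonneg ht.1.le k))
  -- Here `s n ^ k = e^(-k/n)`, so a bump on `[e^(-x₂), e^(-x₁)]` selects the indices `k` with `x₁ n
  -- ≤ k ≤ x₂ n`.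
  set s : ℕ → ℝ := fun n => Real.exp (-(1 / (n : ℝ))) with hsdef
  have hsmem : ∀ᶠ n in atTop, s n ∈ Ioo (0 : ℝ) 1 :=
    tendsto_exp_neg_inv_nat.eventually (Ioo_mem_nhdsLT (zero_lt_one' ℝ))
  have hpow : ∀ n k : ℕ, s n ^ k = Real.exp (-((k : ℝ) / n)) := fun n k => by
    simp only [hsdef, ← Real.exp_nat_mul]; congr 1; ring
  suffices h : Tendsto (fun n => a n * (1 - s n) ^ (ρ - 1)) atTop
      (𝓝 (A * (Real.Gamma ρ)⁻¹)) by
    have h2 := tendsto_mul_one_sub_exp_neg_inv_nat.rpow_const (p := 1 - ρ)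
      (Or.inr (by linarith))
    have h3 := h.mul h2
    rw [Real.one_rpow, mul_one] at h3
    refine h3.congr' ?_
    filter_upwards [hsmem] with n hn
    have h1 : 0 < 1 - s n := by linarith [hn.2]
    rw [Real.mul_rpow (Nat.cast_nonneg n) h1.le, mul_comm ((n : ℝ) ^ (1 - ρ)), ← mul_assoc,
      mul_assoc (a n), ← Real.rpow_add h1]
    simp
  have hquot : ∀ x₁ x₂ : ℝ, 0 < x₁ → x₁ < x₂ → Tendsto (fun n =>
      abelMean a ρ (s n) (bump (Real.exp (-x₂)) (Real.exp (-x₁))) /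
        abelMean (fun _ => 1) 1 (s n) (bump (Real.exp (-x₂)) (Real.exp (-x₁)))) atTop
      (𝓝 (A * gammaMean ρ (bump (Real.exp (-x₂)) (Real.exp (-x₁))) /
        gammaMean 1 (bump (Real.exp (-x₂)) (Real.exp (-x₁))))) := fun x₁ x₂ h₁ h₁₂ =>
    ((tendsto_abelMean hρ ha hs hA (continuous_bump _ _).continuousOn).comp
      tendsto_exp_neg_inv_nat).div ((tendsto_abelMean_one (continuous_bump _ _).continuousOn).comp
      tendsto_exp_neg_inv_nat) (gammaMean_one_bump_pos h₁.le h₁₂).ne'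
  have hpos : ∀ x₁ x₂ : ℝ, 0 < x₁ → x₁ < x₂ → ∀ᶠ n in atTop,
      0 < abelMean (fun _ => 1) 1 (s n) (bump (Real.exp (-x₂)) (Real.exp (-x₁))) :=
    fun x₁ x₂ h₁ h₁₂ => ((tendsto_abelMean_one (continuous_bump _ _).continuousOn).comp
      tendsto_exp_neg_inv_nat).eventually_const_lt (gammaMean_one_bump_pos h₁.le h₁₂)
  have hcont : Tendsto (fun x : ℝ => A * ((Real.Gamma ρ)⁻¹ * x ^ (ρ - 1))) (𝓝 1)
      (𝓝 (A * (Real.Gamma ρ)⁻¹)) := by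
    have : Tendsto (fun x : ℝ => x ^ (ρ - 1)) (𝓝 1) (𝓝 (1 ^ (ρ - 1))) :=
      (Real.continuousAt_rpow_const 1 (ρ - 1) (Or.inl one_ne_zero)).tendsto
    rw [Real.one_rpow] at this
    simpa using (this.const_mul (Real.Gamma ρ)⁻¹).const_mul A
  rw [tendsto_order]
  constructor
  -- The window `[n, xn]` with `x` slightly above `1`: there `a k ≤ a n`, so the windowed mean
  -- bounds `a n` from below.
  · intro c hc
    obtain ⟨x, hxc, hx1⟩ := (((hcont.mono_left (nhdsWithin_le_nhds (s := Ioi 1))).eventually_const_lt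
      hc).and self_mem_nhdsWithin).exists
    have hx1 : 1 < x := hx1
    have hb := (gammaMean_bump_bounds one_pos hx1 hρ hρ1).1
    have hJ := gammaMean_one_bump_pos zero_le_one hx1
    have hlt : c < A * gammaMean ρ (bump (Real.exp (-x)) (Real.exp (-1))) /
        gammaMean 1 (bump (Real.exp (-x)) (Real.exp (-1))) := by
      refine hxc.trans_le ?_
      rw [le_div_iff₀ hJ, mul_assoc]
      exact mul_le_mul_of_nonneg_left hb hA0
    filter_upwards [(hquot 1 x one_pos hx1).eventually_const_lt hlt, hpos 1 x one_pos hx1, hsmem,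
      eventually_gt_atTop 0] with n hn hp hsn hn0
    refine hn.trans_le ?_
    rw [div_le_iff₀ hp]
    refine abelMean_le_of_support ha hsn (hs _ hsn) (continuous_bump _ _).continuousOn
      (bump_nonneg _ _) fun k hk => hanti ?_
    by_contra hkn
    refine hk (bump_eq_zero (Real.exp_lt_exp.2 (by linarith)) fun hmem => hkn ?_)
    have := hmem.2
    rw [hpow, Real.exp_le_exp, neg_le_neg_iff, one_le_div (Nat.cast_pos.2 hn0)] at this
    exact_mod_cast this
  -- The mirror window `[xn, n]` with `x` slightly below `1`, where `a n ≤ a k`.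
  · intro c hc
    obtain ⟨x, hxc, hx0, hx1⟩ := (((hcont.mono_left (nhdsWithin_le_nhds (s := Iio 1))).eventually_lt_const
      hc).and (eventually_mem_set.2 (Ioo_mem_nhdsLT (zero_lt_one' ℝ)))).exists
    have hb := (gammaMean_bump_bounds hx0 hx1 hρ hρ1).2
    have hJ := gammaMean_one_bump_pos hx0.le hx1
    have hlt : A * gammaMean ρ (bump (Real.exp (-1)) (Real.exp (-x))) /
        gammaMean 1 (bump (Real.exp (-1)) (Real.exp (-x))) < c := by
      refine lt_of_le_of_lt ?_ hxc
      rw [div_le_iff₀ hJ, mul_assoc]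
      exact mul_le_mul_of_nonneg_left hb hA0
    filter_upwards [(hquot x 1 hx0 hx1).eventually_lt_const hlt, hpos x 1 hx0 hx1, hsmem,
      eventually_gt_atTop 0] with n hn hp hsn hn0
    refine lt_of_le_of_lt ?_ hn
    rw [le_div_iff₀ hp]
    refine le_abelMean_of_support ha hsn (hs _ hsn) (continuous_bump _ _).continuousOn
      (bump_nonneg _ _) fun k hk => hanti ?_
    by_contra hkn
    refine hk (bump_eq_zero (Real.exp_lt_exp.2 (by linarith)) fun hmem => hkn ?_)
    have := hmem.1
    rw [hpow, Real.exp_le_exp, neg_le_neg_iff, div_le_one (Nat.cast_pos.2 hn0)] at this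
    exact_mod_cast this

end Tauberian

/-! ### From tail sums to the sequence, and from integers to reals -/

section MonotoneDensity

/-- `T n - T m` is a signed sum of `p` over the indices between `n` and `m`. Terms to the right of
`n` are at most `p n`; those up to `n` are at least `p n` and enter with a minus sign. So one
inequality covers both orders. -/
theorem tail_sum_sub_le {p T : ℕ → ℝ} (hp : Antitone p) (hT : ∀ n, T n = T (n + 1) + p (n + 1))
    (n m : ℕ) : T n - T m ≤ ((m : ℝ) - n) * p n := by
  have hup : ∀ k, T n - T (n + k) ≤ (k : ℝ) * p n := fun k => by
    induction k with
    | zero => simp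
    | succ k ih =>
      have := hT (n + k)
      have h2 : p (n + k + 1) ≤ p n := hp (by omega)
      push_cast
      rw [← add_assoc]
      linarith
  have hdown : ∀ k, ∀ m, n = m + k → (k : ℝ) * p n ≤ T m - T n := fun k => by
    induction k with
    | zero => rintro m rfl; simp
    | succ k ih =>
      intro m hm
      have h1 := ih (m + 1) (by omega)
      have := hT m
      have h2 : p n ≤ p (m + 1) := hp (by omega)
      push_cast
      linarith
  rcases le_total n m with h | h
  · obtain ⟨k, rfl⟩ := Nat.exists_eq_add_of_le h
    simpa using hup k
  · obtain ⟨k, rfl⟩ := Nat.exists_eq_add_of_le h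
    have := hdown k m rfl
    push_cast at this ⊢
    linarith

/-- The monotone density theorem for tail sums of order `n ^ (-1/2)`. -/
theorem tendsto_of_tendsto_tail_sum {p T : ℕ → ℝ} {c : ℝ} (hp : Antitone p)
    (hT : ∀ n, T n = T (n + 1) + p (n + 1))
    (hc : Tendsto (fun n : ℕ => T n * (n : ℝ) ^ (1 / 2 : ℝ)) atTop (𝓝 c)) :
    Tendsto (fun n : ℕ => p n * (n : ℝ) ^ (3 / 2 : ℝ)) atTop (𝓝 (c / 2)) := by
  -- The rescaled increments of `T` between `n` and `⌊l n⌋` converge to the slope of this `f`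
  -- between `1` and `l`. The target constant is `f' 1 = c/2`.
  set f : ℝ → ℝ := fun x => -c * x ^ (-(1 / 2) : ℝ) with hf
  have hd : HasDerivAt f (c / 2) 1 := by
    have := (Real.hasDerivAt_rpow_const (x := 1) (p := (-(1 / 2) : ℝ))
      (Or.inl one_ne_zero)).const_mul (-c)
    convert! this using 1
    rw [Real.one_rpow]; ring
  have hslope := hasDerivAt_iff_tendsto_slope.1 hd
  have hfloor : ∀ l : ℝ, 0 < l → Tendsto (fun n : ℕ => (⌊l * n⌋₊ : ℝ) / n) atTop (𝓝 l) :=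
    fun l hl => (tendsto_nat_floor_mul_div_atTop hl.le).comp tendsto_natCast_atTop_atTop
  have hfloor' : ∀ l : ℝ, 0 < l → Tendsto (fun n : ℕ => ⌊l * n⌋₊) atTop atTop :=
    fun l hl => tendsto_nat_floor_atTop.comp
      (tendsto_natCast_atTop_atTop.const_mul_atTop hl)
  set q : ℝ → ℕ → ℝ := fun l n => (T n * (n : ℝ) ^ (1 / 2 : ℝ) -
    T ⌊l * n⌋₊ * (n : ℝ) ^ (1 / 2 : ℝ)) / ((⌊l * n⌋₊ : ℝ) / n - 1) with hq
  have hqlim : ∀ l, 0 < l → l ≠ 1 → Tendsto (q l) atTop (𝓝 (slope f 1 l)) := fun l hl hl1 => by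
    have h1 : Tendsto (fun n : ℕ => T ⌊l * n⌋₊ * (n : ℝ) ^ (1 / 2 : ℝ)) atTop
        (𝓝 (c * l ^ (-(1 / 2) : ℝ))) := by
      have := (hc.comp (hfloor' l hl)).mul ((hfloor l hl).rpow_const (p := (-(1 / 2) : ℝ))
        (Or.inl hl.ne'))
      refine this.congr' ?_
      filter_upwards [(hfloor' l hl).eventually_gt_atTop 0, eventually_gt_atTop 0] with n h h'
      have hm : (0 : ℝ) < (⌊l * n⌋₊ : ℝ) := Nat.cast_pos.2 h
      have hn : (0 : ℝ) < n := Nat.cast_pos.2 h'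
      simp only [Function.comp]
      rw [Real.div_rpow hm.le hn.le, Real.rpow_neg hm.le, Real.rpow_neg hn.le]
      have := (Real.rpow_pos_of_pos hm (1 / 2)).ne'
      field_simp
    have h2 := (hc.sub h1).div ((hfloor l hl).sub_const 1) (sub_ne_zero.2 hl1)
    refine h2.trans_eq ?_
    rw [slope_def_field]
    simp only [hf, Real.one_rpow]
    ring_nf
  have key : ∀ l : ℝ, ∀ n : ℕ, 0 < n → T n * (n : ℝ) ^ (1 / 2 : ℝ) -
      T ⌊l * n⌋₊ * (n : ℝ) ^ (1 / 2 : ℝ)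
        ≤ ((⌊l * n⌋₊ : ℝ) / n - 1) * (p n * (n : ℝ) ^ (3 / 2 : ℝ)) := fun l n h => by
    have hn : (0 : ℝ) < n := Nat.cast_pos.2 h
    have h1 := mul_le_mul_of_nonneg_right (tail_sum_sub_le hp hT n ⌊l * n⌋₊)
      (Real.rpow_nonneg hn.le (1 / 2))
    have h2 : (n : ℝ) ^ (3 / 2 : ℝ) = n * (n : ℝ) ^ (1 / 2 : ℝ) := by
      rw [← Real.rpow_one_add' hn.le (by norm_num)]; norm_num
    have h3 : ((⌊l * n⌋₊ : ℝ) / n - 1) * (p n * (n : ℝ) ^ (3 / 2 : ℝ))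
        = ((⌊l * n⌋₊ : ℝ) - n) * p n * (n : ℝ) ^ (1 / 2 : ℝ) := by
      rw [h2]; field_simp
    rw [h3, ← sub_mul]
    exact h1
  have hgt : 𝓝[>] (1 : ℝ) ≤ 𝓝[≠] 1 := nhdsWithin_mono 1 fun x hx => (mem_Ioi.1 hx).ne'
  have hlt : 𝓝[<] (1 : ℝ) ≤ 𝓝[≠] 1 := nhdsWithin_mono 1 fun x hx => (mem_Iio.1 hx).ne
  -- Dividing `key` by `⌊l n⌋/n - 1` gives a lower bound when `l > 1` and, with the sign reversed,
  -- an upper bound when `l < 1`. Then `l` is taken close to `1`.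
  rw [tendsto_order]
  constructor
  · intro b hb
    obtain ⟨l, hlb, hl1⟩ := (((hslope.mono_left hgt).eventually_const_lt hb).and
      (eventually_mem_set.2 self_mem_nhdsWithin)).exists
    have hl1 : 1 < l := hl1
    have hl0 : 0 < l := by linarith
    filter_upwards [(hqlim l hl0 hl1.ne').eventually_const_lt hlb, eventually_gt_atTop 0,
      (hfloor l hl0).eventually_const_lt hl1] with n hn h0 hf1
    refine hn.trans_le ?_
    rw [hq, div_le_iff₀ (by linarith), mul_comm (p n * _)]
    exact key l n h0
  · intro b hb
    obtain ⟨l, hlb, hl0, hl1⟩ := (((hslope.mono_left hlt).eventually_lt_const hb).and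
      (eventually_mem_set.2 (Ioo_mem_nhdsLT (zero_lt_one' ℝ)))).exists
    filter_upwards [(hqlim l hl0 hl1.ne).eventually_lt_const hlb, eventually_gt_atTop 0,
      (hfloor l hl0).eventually_lt_const hl1] with n hn h0 hf1
    refine lt_of_le_of_lt ?_ hn
    rw [hq, le_div_iff_of_neg (by linarith), mul_comm (p n * _)]
    exact key l n h0

theorem isEquivalent_floor_of_tendsto {p : ℕ → ℝ} {r c : ℝ} (hc : c ≠ 0)
    (h : Tendsto (fun n : ℕ => p n * (n : ℝ) ^ r) atTop (𝓝 c)) :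
    (fun x : ℝ => p ⌊x⌋₊) ~[atTop] fun x : ℝ => c * x ^ (-r) := by
  have hf : Tendsto (fun x : ℝ => (⌊x⌋₊ : ℝ) / x) atTop (𝓝 1) := tendsto_nat_floor_div_atTop
  have h1 := (h.comp tendsto_nat_floor_atTop).mul (hf.rpow_const (p := -r)
    (Or.inl one_ne_zero))
  rw [Real.one_rpow, mul_one] at h1
  rw [isEquivalent_iff_tendsto_one]
  · have h2 := h1.div_const c
    rw [div_self hc] at h2
    refine h2.congr' ?_
    filter_upwards [eventually_ge_atTop 1] with x hx
    have hx0 : 0 < x := by linarith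
    have hm : (0 : ℝ) < (⌊x⌋₊ : ℝ) := Nat.cast_pos.2 (Nat.floor_pos.2 hx)
    simp only [Function.comp, Pi.div_apply]
    rw [Real.div_rpow hm.le hx0.le, Real.rpow_neg hm.le, Real.rpow_neg hx0.le]
    have := (Real.rpow_pos_of_pos hm r).ne'
    have := (Real.rpow_pos_of_pos hx0 r).ne'
    field_simp
  · filter_upwards [eventually_gt_atTop 0] with x hx
    exact mul_ne_zero hc (Real.rpow_pos_of_pos hx _).ne'

end MonotoneDensity

/-! ### Finite moments from a smooth Laplace transform -/

section Moments

variable {Ω : Type*} [MeasurableSpace Ω] {μ : Measure Ω} [IsProbabilityMeasure μ]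

theorem integrable_exp_mul_of_nonpos {N : Ω → ℕ} (hN : Measurable N) {s : ℝ} (hs : s ≤ 0) :
    Integrable (fun ω => Real.exp (s * N ω)) μ := by
  refine Integrable.of_bound (C := 1) (by fun_prop) (ae_of_all _ fun ω => ?_)
  rw [Real.norm_of_nonneg (Real.exp_pos _).le, Real.exp_le_one_iff]
  exact mul_nonpos_of_nonpos_of_nonneg hs (Nat.cast_nonneg _)

/-- If the Laplace transform of a random variable with values in `ℕ` extends smoothly through `0`,
all its moments are finite. -/
theorem lintegral_pow_lt_top_of_mgf_eqOn {N : Ω → ℕ} (hN : Measurable N) {Φ : ℝ → ℝ}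
    (hΦ : AnalyticAt ℝ Φ 0) (h : ∀ᶠ s in 𝓝[<] 0, mgf (fun ω => (N ω : ℝ)) μ s = Φ s) (j : ℕ) :
    ∫⁻ ω, (N ω : ℝ≥0∞) ^ j ∂μ < ∞ := by
  obtain ⟨l, hl, hlΦ⟩ := (mem_nhdsLT_iff_exists_Ioo_subset' (show (-1 : ℝ) < 0 by norm_num)).1 h
  have hint : ∀ s < 0, s ∈ interior (integrableExpSet (fun ω => (N ω : ℝ)) μ) := fun s hs =>
    interior_maximal (t := Iio 0) (fun s hs => integrable_exp_mul_of_nonpos hN (le_of_lt hs))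
      isOpen_Iio hs
  have hmom : ∀ s ∈ Ioo l 0, ∫ ω, (N ω : ℝ) ^ j * Real.exp (s * N ω) ∂μ = iteratedDeriv j Φ s :=
    fun s hs => by
      rw [← iteratedDeriv_mgf (hint s hs.2) j]
      refine Filter.EventuallyEq.iteratedDeriv_eq j ?_
      filter_upwards [isOpen_Ioo.mem_nhds hs] with s hs using hlΦ hs
  have hcont : ContinuousAt (iteratedDeriv j Φ) 0 := by
    rw [iteratedDeriv_eq_iterate]
    exact (hΦ.iterated_deriv j).continuousAt
  have hs : Tendsto (fun n : ℕ => -(1 / ((n : ℝ) + 1))) atTop (𝓝 0) := by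
    simpa using (tendsto_one_div_add_atTop_nhds_zero_nat (𝕜 := ℝ)).neg
  -- Along `s = -1/(n+1)` increasing to `0`, the integrals of `N^j e^(sN)` increase to the `j`-th
  -- moment. They are also derivatives of `Φ`, whose limit at `0` is finite.
  have hlim : Tendsto (fun n : ℕ => ∫⁻ ω, ENNReal.ofReal ((N ω : ℝ) ^ j *
      Real.exp (-(1 / ((n : ℝ) + 1)) * N ω)) ∂μ) atTop
      (𝓝 (∫⁻ ω, (N ω : ℝ≥0∞) ^ j ∂μ)) := by
    refine lintegral_tendsto_of_tendsto_of_monotone (fun n => by fun_prop)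
      (ae_of_all _ fun ω => ?_) (ae_of_all _ fun ω => ?_)
    · intro n m hnm
      refine ENNReal.ofReal_le_ofReal (mul_le_mul_of_nonneg_left (Real.exp_le_exp.2
        (mul_le_mul_of_nonneg_right (neg_le_neg ?_) (Nat.cast_nonneg _))) (by positivity))
      exact one_div_le_one_div_of_le (by positivity) (by gcongr)
    · have h1 : Tendsto (fun n : ℕ => (N ω : ℝ) ^ j * Real.exp (-(1 / ((n : ℝ) + 1)) * N ω)) atTop
          (𝓝 ((N ω : ℝ) ^ j * Real.exp (0 * N ω))) :=
        ((Real.continuous_exp.tendsto _).comp (hs.mul_const _)).const_mul _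
      have h2 := (ENNReal.continuous_ofReal.tendsto _).comp h1
      rw [zero_mul, Real.exp_zero, mul_one, ENNReal.ofReal_pow (Nat.cast_nonneg _),
        ENNReal.ofReal_natCast] at h2
      exact h2
  have hlim2 : Tendsto (fun n : ℕ => ∫⁻ ω, ENNReal.ofReal ((N ω : ℝ) ^ j *
      Real.exp (-(1 / ((n : ℝ) + 1)) * N ω)) ∂μ) atTop
      (𝓝 (ENNReal.ofReal (iteratedDeriv j Φ 0))) := by
    refine ((ENNReal.continuous_ofReal.tendsto _).comp (hcont.tendsto.comp hs)).congr' ?_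
    filter_upwards [hs.eventually_const_lt hl] with n hn
    have hneg : -(1 / ((n : ℝ) + 1)) < 0 := by
      rw [neg_lt_zero]; positivity
    simp only [Function.comp]
    rw [← hmom _ ⟨hn, hneg⟩, ofReal_integral_eq_lintegral_ofReal]
    · exact integrable_pow_mul_exp_of_mem_interior_integrableExpSet (hint _ hneg) j
    · exact ae_of_all _ fun ω => by positivity
  rw [tendsto_nhds_unique hlim hlim2]
  exact ENNReal.ofReal_lt_top

end Moments

/-! ### Generating functions through tails -/

section GeneratingFunction

variable {Ω : Type*} [MeasurableSpace Ω] {μ : Measure Ω} [IsProbabilityMeasure μ]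

/-- The probability generating function in terms of the tail probabilities. -/
theorem integral_pow_eq_one_sub {N : Ω → ℕ} (hN : Measurable N) {t : ℝ} (ht : t ∈ Ico (0 : ℝ) 1) :
    ∫ ω, t ^ N ω ∂μ = 1 - (1 - t) * ∑' k : ℕ, μ.real {ω | k < N ω} * t ^ k := by
  have h1 : 1 - t ≠ 0 := by linarith [ht.2]
  have hms : ∀ k, MeasurableSet {ω | k < N ω} := fun k => measurableSet_lt measurable_const hN
  have hint : ∀ k, ∫ ω, {ω | k < N ω}.indicator (fun _ => t ^ k) ω ∂μ
      = μ.real {ω | k < N ω} * t ^ k := fun k => by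
    rw [integral_indicator_const _ (hms k), smul_eq_mul]
  have hnn : ∀ k ω, 0 ≤ {ω | k < N ω}.indicator (fun _ => t ^ k) ω := fun k ω =>
    indicator_nonneg (fun _ _ => pow_nonneg ht.1 k) ω
  have hs := hasSum_integral_of_summable_integral_norm (μ := μ)
    (F := fun k => {ω | k < N ω}.indicator (fun _ => t ^ k))
    (fun k => (integrable_const _).indicator (hms k)) (by
      simp only [Real.norm_of_nonneg (hnn _ _), hint]
      exact (summable_geometric_of_lt_one ht.1 ht.2).of_nonneg_of_le
        (fun k => mul_nonneg measureReal_nonneg (pow_nonneg ht.1 k))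
        fun k => mul_le_of_le_one_left (pow_nonneg ht.1 k) measureReal_le_one)
  have hpt : ∀ ω, ∑' k, {ω | k < N ω}.indicator (fun _ => t ^ k) ω
      = (1 - t ^ N ω) / (1 - t) := fun ω => by
    rw [tsum_eq_sum (s := Finset.range (N ω)), eq_div_iff h1, ← geom_sum_mul_neg]
    · congr 1
      refine Finset.sum_congr rfl fun k hk => ?_
      simp [Finset.mem_range.1 hk]
    · intro k hk
      simpa [indicator] using fun h => absurd (Finset.mem_range.2 h) hk
  simp only [hint, hpt] at hs
  have hi : Integrable (fun ω => t ^ N ω) μ := by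
    refine Integrable.of_bound (C := 1) (by fun_prop) (ae_of_all _ fun ω => ?_)
    rw [Real.norm_of_nonneg (pow_nonneg ht.1 _)]
    exact pow_le_one₀ ht.1 ht.2.le
  rw [hs.tsum_eq, integral_div, integral_sub (integrable_const _) hi, mul_div_cancel₀ _ h1]
  simp

end GeneratingFunction

/-! ### Measurability and subtrees of the truncated runoff -/

section Structure

variable {Ω : Type*}

theorem measurable_sum_range [MeasurableSpace Ω] {Z : Ω → ℕ} {f : ℕ → Ω → ℤ} (hZ : Measurable Z)
    (hf : ∀ i, Measurable (f i)) : Measurable fun ω => ∑ i ∈ Finset.range (Z ω), f i ω := by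
  have h : Measurable fun q : ℕ × Ω => ∑ i ∈ Finset.range q.1, f i q.2 :=
    measurable_from_prod_countable_right fun n =>
      Finset.measurable_sum (Finset.range n) fun i _ => hf i
  exact h.comp (hZ.prodMk measurable_id)

theorem measurable_truncRunoff [MeasurableSpace Ω] {Z : List ℕ → Ω → ℕ} {X : List ℕ → Ω → ℤ}
    (n : ℕ) (v : List ℕ) (hZ : ∀ w, v <+: w → Measurable (Z w))
    (hX : ∀ w, v <+: w → Measurable (X w)) :
    Measurable fun ω => truncRunoff (fun w => Z w ω) (fun w => X w ω) n v := by
  induction n generalizing v with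
  | zero => exact (hX v List.prefix_rfl).max measurable_const
  | succ n ih =>
    refine Measurable.max (Measurable.add (hX v List.prefix_rfl) ?_) measurable_const
    exact measurable_sum_range (hZ v List.prefix_rfl) fun i => ih _
      (fun w hw => hZ w ((List.prefix_append _ _).trans hw))
      (fun w hw => hX w ((List.prefix_append _ _).trans hw))

/-- The runoff from `v` is the root runoff of the relabelled subtree. This self-similarity is what
transfers distributions from the root to its children. -/
theorem truncRunoff_append (Z : List ℕ → ℕ) (X : List ℕ → ℤ) (n : ℕ) (v w : List ℕ) :
    truncRunoff Z X n (v ++ w)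
      = truncRunoff (fun u => Z (v ++ u)) (fun u => X (v ++ u)) n w := by
  induction n generalizing w with
  | zero => rfl
  | succ n ih =>
    simp only [truncRunoff]
    congr 2
    refine Finset.sum_congr rfl fun i _ => ?_
    rw [List.append_assoc, ih]

/-- The truncated runoff `truncRunoff` of the node `v` as a natural-number-valued variable. -/
def truncValue (Z : List ℕ → Ω → ℕ) (X : List ℕ → Ω → ℤ) (n : ℕ) (v : List ℕ) (ω : Ω) : ℕ :=
  (truncRunoff (fun w => Z w ω) (fun w => X w ω) n v).toNat

theorem truncValue_mono (Z : List ℕ → Ω → ℕ) (X : List ℕ → Ω → ℤ) (v : List ℕ) (ω : Ω) :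
    Monotone fun n => truncValue Z X n v ω :=
  monotone_nat_of_le_succ fun n => Int.toNat_le_toNat (truncRunoff_le_succ _ _ n v)

theorem natCast_truncValue (Z : List ℕ → Ω → ℕ) (X : List ℕ → Ω → ℤ) (n : ℕ) (v : List ℕ)
    (ω : Ω) : (truncValue Z X n v ω : ℤ) = truncRunoff (fun w => Z w ω) (fun w => X w ω) n v :=
  Int.toNat_of_nonneg (truncRunoff_nonneg _ _ n v)

theorem W_eq_iSup (Z : List ℕ → Ω → ℕ) (X : List ℕ → Ω → ℤ) (ω : Ω) :
    W Z X ω = ⨆ n, (truncValue Z X n [] ω : ℝ≥0∞) := by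
  simp only [W, rootRunoff, ← natCast_truncValue, Int.cast_natCast, ENNReal.ofReal_natCast]

/-- Truncated runoffs are integers, so exceeding `x` is the same as exceeding `⌊x⌋`, and a supremum
exceeds a level exactly when some term does. -/
theorem ofReal_lt_W_iff (Z : List ℕ → Ω → ℕ) (X : List ℕ → Ω → ℤ) {x : ℝ} (hx : 0 ≤ x) (ω : Ω) :
    ENNReal.ofReal x < W Z X ω ↔ ∃ n, ⌊x⌋₊ < truncValue Z X n [] ω := by
  rw [W_eq_iSup, lt_iSup_iff]
  refine exists_congr fun n => ?_
  rw [Nat.floor_lt hx, ENNReal.ofReal_lt_iff_lt_toReal hx (ENNReal.natCast_ne_top _),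
    ENNReal.toReal_natCast]

end Structure

/-! ### Tail and generating function of the root runoff -/

section Model

variable {Ω : Type*} [MeasurableSpace Ω] {μ : Measure Ω} [IsProbabilityMeasure μ]
  {Z : List ℕ → Ω → ℕ} {X : List ℕ → Ω → ℤ}

theorem tail_eq_tail_floor {x : ℝ} (hx : 0 ≤ x) :
    tail μ Z X x = tail μ Z X (⌊x⌋₊ : ℕ) := by
  simp only [tail, ofReal_lt_W_iff Z X hx, ofReal_lt_W_iff Z X (Nat.cast_nonneg _),
    Nat.floor_natCast]

theorem antitone_tail : Antitone fun k : ℕ => tail μ Z X k := fun a b hab =>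
  measureReal_mono fun _ hω =>
    (ENNReal.ofReal_le_ofReal (Nat.cast_le.2 hab)).trans_lt hω

theorem tendsto_tail_trunc (k : ℕ) :
    Tendsto (fun n => μ.real {ω | k < truncValue Z X n [] ω}) atTop (𝓝 (tail μ Z X k)) := by
  have hU : {ω | ENNReal.ofReal (k : ℝ) < W Z X ω} = ⋃ n, {ω | k < truncValue Z X n [] ω} := by
    ext ω
    simp [ofReal_lt_W_iff Z X (Nat.cast_nonneg k), -ENNReal.ofReal_natCast]
  rw [tail, hU]
  refine (ENNReal.tendsto_toReal (measure_ne_top _ _)).comp (tendsto_measure_iUnion_atTop ?_)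
  exact fun n m hnm ω hω => lt_of_lt_of_le hω (truncValue_mono Z X [] ω hnm)

/-- The generating function of the root runoff, expressed through its tail. -/
noncomputable def runoffGF (μ : Measure Ω) (Z : List ℕ → Ω → ℕ) (X : List ℕ → Ω → ℤ)
    (t : ℝ) : ℝ :=
  1 - (1 - t) * ∑' k : ℕ, tail μ Z X k * t ^ k

theorem summable_tail {t : ℝ} (ht : t ∈ Ico (0 : ℝ) 1) :
    Summable fun k : ℕ => tail μ Z X k * t ^ k :=
  (summable_geometric_of_lt_one ht.1 ht.2).of_nonneg_of_le
    (fun k => mul_nonneg measureReal_nonneg (pow_nonneg ht.1 k))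
    fun k => mul_le_of_le_one_left (pow_nonneg ht.1 k) measureReal_le_one

theorem runoffGF_le_one {t : ℝ} (ht : t ∈ Ico (0 : ℝ) 1) : runoffGF μ Z X t ≤ 1 := by
  have : 0 ≤ (1 - t) * ∑' k : ℕ, tail μ Z X k * t ^ k :=
    mul_nonneg (by linarith [ht.2]) (tsum_nonneg fun k =>
      mul_nonneg measureReal_nonneg (pow_nonneg ht.1 k))
  rw [runoffGF]; linarith

theorem runoffGF_nonneg {t : ℝ} (ht : t ∈ Ico (0 : ℝ) 1) : 0 ≤ runoffGF μ Z X t := by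
  have h1 : 0 < 1 - t := by linarith [ht.2]
  have : (1 - t) * ∑' k : ℕ, tail μ Z X k * t ^ k ≤ (1 - t) * (1 - t)⁻¹ := by
    refine mul_le_mul_of_nonneg_left ?_ h1.le
    rw [← tsum_geometric_of_lt_one ht.1 ht.2]
    exact (summable_tail ht).tsum_le_tsum (fun k => mul_le_of_le_one_left (pow_nonneg ht.1 k)
      measureReal_le_one) (summable_geometric_of_lt_one ht.1 ht.2)
  rw [mul_inv_cancel₀ h1.ne'] at this
  rw [runoffGF]; linarith

theorem continuousOn_runoffGF : ContinuousOn (runoffGF μ Z X) (Ico 0 1) := by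
  refine continuousOn_const.sub ((by fun_prop : ContinuousOn (fun t : ℝ => 1 - t) _).mul ?_)
  intro t ht
  obtain ⟨r, htr, hr1⟩ := exists_between ht.2
  have hc : ContinuousOn (fun t : ℝ => ∑' k : ℕ, tail μ Z X k * t ^ k) (Icc 0 r) :=
    continuousOn_tsum (u := fun k => r ^ k) (fun k => by fun_prop)
      (summable_geometric_of_lt_one (ht.1.trans htr.le) hr1) fun k x hx => by
        rw [norm_mul, tail, Real.norm_of_nonneg measureReal_nonneg,
          Real.norm_of_nonneg (pow_nonneg hx.1 k)]
        exact (mul_le_of_le_one_left (pow_nonneg hx.1 k) measureReal_le_one).trans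
          (pow_le_pow_left₀ hx.1 hx.2 k)
  refine (hc t ⟨ht.1, htr.le⟩).mono_of_mem_nhdsWithin ?_
  filter_upwards [self_mem_nhdsWithin, mem_nhdsWithin_of_mem_nhds (Iio_mem_nhds htr)] with x h1 h2
  exact ⟨h1.1, (mem_Iio.1 h2).le⟩

namespace IsBGWRunoffModel

variable {β : ℝ} (hm : IsBGWRunoffModel μ β Z X)

include hm

theorem measurable_trunc (n : ℕ) (v : List ℕ) :
    Measurable fun ω => truncRunoff (fun w => Z w ω) (fun w => X w ω) n v :=
  measurable_truncRunoff n v (fun w _ => hm.measurable_offspring w)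
    fun w _ => hm.measurable_contribution w

theorem measurable_truncValue (n : ℕ) (v : List ℕ) : Measurable (truncValue Z X n v) :=
  (measurable_of_countable Int.toNat).comp (hm.measurable_trunc n v)

theorem measurable_W : Measurable (W Z X) := by
  simp only [funext (W_eq_iSup Z X)]
  exact Measurable.iSup fun n =>
    (measurable_of_countable (fun k : ℕ => (k : ℝ≥0∞))).comp (hm.measurable_truncValue n [])

theorem measurable_node (v : List ℕ) : Measurable fun ω => (Z v ω, X v ω) :=
  (hm.measurable_offspring v).prodMk (hm.measurable_contribution v)

end IsBGWRunoffModel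

end Model

/-! ### Independence and the functional equation -/

section Recursion

variable {Ω : Type*} [MeasurableSpace Ω] {μ : Measure Ω} [IsProbabilityMeasure μ]
  {Z : List ℕ → Ω → ℕ} {X : List ℕ → Ω → ℤ}

/-- The `σ`-algebra generated by the variables at the nodes in `S`. -/
@[reducible] def nodeSigma (Z : List ℕ → Ω → ℕ) (X : List ℕ → Ω → ℤ) (S : Set (List ℕ)) : MeasurableSpace Ω :=
  ⨆ v ∈ S, MeasurableSpace.comap (fun ω => (Z v ω, X v ω)) inferInstance

theorem measurable_nodeSigma (Z : List ℕ → Ω → ℕ) (X : List ℕ → Ω → ℤ) {S : Set (List ℕ)}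
    {v : List ℕ} (hv : v ∈ S) : Measurable[nodeSigma Z X S] fun ω => (Z v ω, X v ω) :=
  (comap_measurable _).mono (le_iSup₂_of_le v hv le_rfl) le_rfl

theorem measurable_truncValue_nodeSigma (Z : List ℕ → Ω → ℕ) (X : List ℕ → Ω → ℤ) (n : ℕ)
    (v : List ℕ) : Measurable[nodeSigma Z X {w | v <+: w}] (truncValue Z X n v) := by
  have h : Measurable[nodeSigma Z X {w | v <+: w}]
      fun ω => truncRunoff (fun w => Z w ω) (fun w => X w ω) n v := by
    refine @measurable_truncRunoff Ω (nodeSigma Z X {w | v <+: w}) Z X n v (fun w hw => ?_)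
      (fun w hw => ?_)
    · exact measurable_fst.comp (measurable_nodeSigma Z X (S := {w | v <+: w}) hw)
    · exact measurable_snd.comp (measurable_nodeSigma Z X (S := {w | v <+: w}) hw)
  exact (measurable_of_countable Int.toNat).comp h

theorem nodeSigma_mono (Z : List ℕ → Ω → ℕ) (X : List ℕ → Ω → ℤ) {S T : Set (List ℕ)}
    (h : S ⊆ T) : nodeSigma Z X S ≤ nodeSigma Z X T :=
  biSup_mono h

/-- Splitting a product over the children of a node with at most two children. -/
theorem prod_range_eq_of_le_two {z : ℕ} (hz : z = 0 ∨ z = 1 ∨ z = 2) (a b₀ b₁ : ℝ) :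
    a * ∏ i ∈ Finset.range z, (if i = 0 then b₀ else b₁) =
      (if z = 0 then a else 0) + (if z = 1 then a else 0) * b₀
        + (if z = 2 then a else 0) * (b₀ * b₁) := by
  rcases hz with rfl | rfl | rfl <;> simp [Finset.prod_range_succ]

theorem integral_ite_eq {Z : Ω → ℕ} {g : Ω → ℝ} (hZ : Measurable Z) (hg : Measurable g)
    (hind : IndepFun Z g μ) (i : ℕ) :
    ∫ ω, (if Z ω = i then g ω else 0) ∂μ = μ.real {ω | Z ω = i} * ∫ ω, g ω ∂μ := by
  have hφ : Measurable fun z : ℕ => if z = i then (1 : ℝ) else 0 := measurable_of_countable _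
  have h1 : IndepFun (fun ω => if Z ω = i then (1 : ℝ) else 0) g μ :=
    hind.comp hφ measurable_id
  have h2 := h1.integral_fun_mul_eq_mul_integral (hφ.comp hZ).aestronglyMeasurable
    hg.aestronglyMeasurable
  simp only [ite_mul, one_mul, zero_mul] at h2
  rw [h2]
  congr 1
  have : (fun ω => if Z ω = i then (1 : ℝ) else 0)
      = {ω | Z ω = i}.indicator fun _ => (1 : ℝ) := by
    ext ω; simp [indicator]
  rw [this, integral_indicator_const _ (measurableSet_eq_fun hZ measurable_const)]
  simp

namespace IsBGWRunoffModel

section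

variable {β : ℝ} (hm : IsBGWRunoffModel μ β Z X)

include hm

theorem indep_nodeSigma {S T : Set (List ℕ)} (hST : Disjoint S T) :
    Indep (nodeSigma Z X S) (nodeSigma Z X T) μ :=
  indep_iSup_of_disjoint (fun v => (hm.measurable_node v).comap_le) hm.indep_nodes.iIndep hST

theorem indepFun_of_disjoint {S T : Set (List ℕ)} (hST : Disjoint S T) {γ δ : Type*}
    [MeasurableSpace γ] [MeasurableSpace δ] {f : Ω → γ} {g : Ω → δ}
    (hf : Measurable[nodeSigma Z X S] f) (hg : Measurable[nodeSigma Z X T] g) :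
    IndepFun f g μ :=
  indep_of_indep_of_le_left (indep_of_indep_of_le_right (hm.indep_nodeSigma hST) hg.comap_le)
    hf.comap_le

theorem indepFun_children (n : ℕ) :
    IndepFun (truncValue Z X n [0]) (truncValue Z X n [1]) μ := by
  refine hm.indepFun_of_disjoint (Set.disjoint_left.2 ?_)
    (measurable_truncValue_nodeSigma Z X n [0]) (measurable_truncValue_nodeSigma Z X n [1])
  intro w h0 h1
  obtain ⟨u, rfl⟩ := h0
  obtain ⟨u', h⟩ := h1
  simp at h

theorem indepFun_root_children (n : ℕ) :
    IndepFun (fun ω => (Z [] ω, X [] ω))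
      (fun ω => (truncValue Z X n [0] ω, truncValue Z X n [1] ω)) μ := by
  refine hm.indepFun_of_disjoint (S := {[]}) (T := {w | [0] <+: w} ∪ {w | [1] <+: w})
    (Set.disjoint_left.2 ?_) (measurable_nodeSigma Z X rfl) ?_
  · rintro w rfl h
    rcases h with ⟨u, h⟩ | ⟨u, h⟩ <;> simp at h
  · exact ((measurable_truncValue_nodeSigma Z X n [0]).mono
      (nodeSigma_mono Z X subset_union_left) le_rfl).prodMk
      ((measurable_truncValue_nodeSigma Z X n [1]).mono
      (nodeSigma_mono Z X subset_union_right) le_rfl)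

end

section

variable (hm : IsBGWRunoffModel μ (1 / 2) Z X)

include hm

theorem ae_offspring_le_two (v : List ℕ) : ∀ᵐ ω ∂μ, Z v ω = 0 ∨ Z v ω = 1 ∨ Z v ω = 2 := by
  have hms : ∀ i, MeasurableSet {ω | Z v ω = i} := fun i =>
    measurableSet_eq_fun (hm.measurable_offspring v) measurable_const
  have h01 : Disjoint {ω | Z v ω = 0} {ω | Z v ω = 1} :=
    Set.disjoint_left.2 fun ω (h : Z v ω = 0) (h' : Z v ω = 1) => by omega
  have h012 : Disjoint ({ω | Z v ω = 0} ∪ {ω | Z v ω = 1}) {ω | Z v ω = 2} :=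
    Set.disjoint_left.2 fun ω (h : Z v ω = 0 ∨ Z v ω = 1) (h' : Z v ω = 2) => by omega
  have h : μ.real (({ω | Z v ω = 0} ∪ {ω | Z v ω = 1}) ∪ {ω | Z v ω = 2}) = 1 := by
    rw [measureReal_union h012 (hms 2), measureReal_union h01 (hms 1), hm.offspring_zero,
      hm.offspring_one, hm.offspring_two]
    norm_num
  have h2 := (prob_compl_eq_zero_iff (((hms 0).union (hms 1)).union (hms 2))).2
    ((ENNReal.toReal_eq_one_iff _).1 h)
  filter_upwards [compl_mem_ae_iff.2 h2] with ω hω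
  have h3 : ¬Z v ω = 0 → ¬Z v ω = 1 → Z v ω = 2 := by simpa using hω
  tauto

theorem identDistrib_offspring (v : List ℕ) : IdentDistrib (Z v) (Z []) μ μ where
  aemeasurable_fst := (hm.measurable_offspring v).aemeasurable
  aemeasurable_snd := (hm.measurable_offspring []).aemeasurable
  map_eq := by
    refine Measure.ext_of_singleton fun i => ?_
    rw [Measure.map_apply (hm.measurable_offspring v) (measurableSet_singleton i),
      Measure.map_apply (hm.measurable_offspring []) (measurableSet_singleton i)]
    have hreal : ∀ w, μ.real {ω | Z w ω = i} = if i = 0 then 1 / 4 else if i = 1 then 1 / 2 else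
        if i = 2 then 1 / 4 else 0 := fun w => by
      by_cases h : i = 0 ∨ i = 1 ∨ i = 2
      · rcases h with rfl | rfl | rfl
        · rw [hm.offspring_zero]; norm_num
        · rw [hm.offspring_one]; norm_num
        · rw [hm.offspring_two]; norm_num
      · push Not at h
        simp only [h.1, h.2.1, h.2.2, if_false]
        rw [measureReal_eq_zero_iff]
        refine measure_mono_null ?_ (hm.ae_offspring_le_two w)
        rintro ω rfl hω
        have := h.1; have := h.2.1; have := h.2.2
        simp_all
    exact (measureReal_eq_measureReal_iff).1 ((hreal v).trans (hreal []).symm)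

theorem identDistrib_node (v : List ℕ) :
    IdentDistrib (fun ω => (Z v ω, X v ω)) (fun ω => (Z [] ω, X [] ω)) μ μ :=
  (hm.identDistrib_offspring v).prodMk (hm.identDistrib v) (hm.indep_at_node v)
    (hm.indep_at_node [])

/-- The variables at the nodes `v ++ w` form an i.i.d. family indexed by `w`, with the same joint
law as the whole tree, and the runoff from `v` is the same measurable functional of it. -/
theorem identDistrib_truncValue (n : ℕ) (v : List ℕ) :
    IdentDistrib (truncValue Z X n v) (truncValue Z X n []) μ μ := by
  have h1 : IdentDistrib (fun ω w => (Z (v ++ w) ω, X (v ++ w) ω)) (fun ω w => (Z w ω, X w ω)) μ μ :=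
    IdentDistrib.pi (fun w => (hm.identDistrib_node (v ++ w)).trans (hm.identDistrib_node w).symm)
      (hm.indep_nodes.precomp (List.append_right_injective v)) hm.indep_nodes
  have hu : Measurable fun q : List ℕ → ℕ × ℤ =>
      (truncRunoff (fun w => (q w).1) (fun w => (q w).2) n []).toNat :=
    (measurable_of_countable Int.toNat).comp
      (measurable_truncRunoff (Z := fun w (q : List ℕ → ℕ × ℤ) => (q w).1)
        (X := fun w (q : List ℕ → ℕ × ℤ) => (q w).2) n []
        (fun w _ => measurable_fst.comp (measurable_pi_apply w))
        (fun w _ => measurable_snd.comp (measurable_pi_apply w)))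
  have h2 := h1.comp hu
  have h3 : truncValue Z X n v = (fun q : List ℕ → ℕ × ℤ =>
      (truncRunoff (fun w => (q w).1) (fun w => (q w).2) n []).toNat) ∘
        fun ω w => (Z (v ++ w) ω, X (v ++ w) ω) := by
    ext ω
    simp only [truncValue, Function.comp]
    rw [← truncRunoff_append (fun w => Z w ω) (fun w => X w ω), List.append_nil]
  rw [h3]
  exact h2

variable (hX : ∀ᵐ ω ∂μ, -1 ≤ X [] ω)

/-- Splitting by the number of children and using independence gives weights `1/4, 1/2, 1/4` on `1,
G, G²`, which is a perfect square. -/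
theorem integral_pow_contribution_mul {t : ℝ} (ht : t ∈ Icc (0 : ℝ) 1) (n : ℕ) :
    ∫ ω, t ^ (X [] ω + 1).toNat *
        t ^ (∑ i ∈ Finset.range (Z [] ω), truncValue Z X n [i] ω) ∂μ
      = (∫ ω, t ^ (X [] ω + 1).toNat ∂μ) *
        ((1 + ∫ ω, t ^ truncValue Z X n [] ω ∂μ) / 2) ^ 2 := by
  set a : Ω → ℝ := fun ω => t ^ (X [] ω + 1).toNat with ha
  set b : ℕ → Ω → ℝ := fun i ω => t ^ truncValue Z X n [i] ω with hb
  have hpow : Measurable fun k : ℕ => t ^ k := measurable_of_countable _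
  have hpowX : Measurable fun k : ℤ => t ^ (k + 1).toNat := measurable_of_countable _
  have ham : Measurable a := hpowX.comp (hm.measurable_contribution [])
  have hbm : ∀ i, Measurable (b i) := fun i => hpow.comp (hm.measurable_truncValue n [i])
  have hZm := hm.measurable_offspring []
  have hbound : ∀ k : ℕ, ‖t ^ k‖ ≤ 1 := fun k => by
    rw [Real.norm_of_nonneg (pow_nonneg ht.1 k)]; exact pow_le_one₀ ht.1 ht.2
  have hbb : ∀ i ω, ‖b i ω‖ ≤ 1 := fun i ω => hbound _
  have hbint : ∀ i, ∫ ω, b i ω ∂μ = ∫ ω, t ^ truncValue Z X n [] ω ∂μ := fun i =>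
    ((hm.identDistrib_truncValue n [i]).comp hpow).integral_eq
  set I : ℕ → Ω → ℝ := fun i ω => if Z [] ω = i then a ω else 0 with hI
  have hIφ : ∀ i, Measurable fun q : ℕ × ℤ => if q.1 = i then t ^ (q.2 + 1).toNat else (0 : ℝ) :=
    fun i => measurable_of_countable _
  have hIm : ∀ i, Measurable (I i) := fun i => (hIφ i).comp (hm.measurable_node [])
  have hIb : ∀ i ω, ‖I i ω‖ ≤ 1 := fun i ω => by
    simp only [hI]; split_ifs
    · exact hbound _
    · simp
  have hIint : ∀ i, ∫ ω, I i ω ∂μ = μ.real {ω | Z [] ω = i} * ∫ ω, a ω ∂μ := fun i =>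
    integral_ite_eq hZm ham ((hm.indep_at_node []).comp measurable_id hpowX) i
  have hindep : ∀ i (ψ : ℕ × ℕ → ℝ), IndepFun (I i)
      (fun ω => ψ (truncValue Z X n [0] ω, truncValue Z X n [1] ω)) μ := fun i ψ =>
    (hm.indepFun_root_children n).comp (hIφ i) (measurable_of_countable ψ)
  have hpt : ∀ᵐ ω ∂μ, a ω * t ^ (∑ i ∈ Finset.range (Z [] ω), truncValue Z X n [i] ω)
      = I 0 ω + I 1 ω * b 0 ω + I 2 ω * (b 0 ω * b 1 ω) := by
    filter_upwards [hm.ae_offspring_le_two []] with ω hω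
    rw [← prod_range_eq_of_le_two hω (a ω) (b 0 ω) (b 1 ω), ← Finset.prod_pow_eq_pow_sum]
    congr 1
    refine Finset.prod_congr rfl fun i hi => ?_
    have := Finset.mem_range.1 hi
    obtain rfl | rfl : i = 0 ∨ i = 1 := by omega
    · simp [hb]
    · simp [hb]
  rw [integral_congr_ae hpt]
  have hi0 : Integrable (I 0) μ := .of_bound (hIm 0).aestronglyMeasurable 1 (ae_of_all _ (hIb 0))
  have hi1 : Integrable (fun ω => I 1 ω * b 0 ω) μ :=
    .of_bound ((hIm 1).mul (hbm 0)).aestronglyMeasurable 1 (ae_of_all _ fun ω => by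
      rw [norm_mul]; exact mul_le_one₀ (hIb 1 ω) (norm_nonneg _) (hbb 0 ω))
  have hi2 : Integrable (fun ω => I 2 ω * (b 0 ω * b 1 ω)) μ :=
    .of_bound ((hIm 2).mul ((hbm 0).mul (hbm 1))).aestronglyMeasurable 1 (ae_of_all _ fun ω => by
      rw [norm_mul, norm_mul]
      exact mul_le_one₀ (hIb 2 ω) (by positivity)
        (mul_le_one₀ (hbb 0 ω) (norm_nonneg _) (hbb 1 ω)))
  have e1 : ∫ ω, I 1 ω * b 0 ω ∂μ = (∫ ω, I 1 ω ∂μ) * ∫ ω, b 0 ω ∂μ :=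
    (hindep 1 fun q => t ^ q.1).integral_fun_mul_eq_mul_integral (hIm 1).aestronglyMeasurable
      (hbm 0).aestronglyMeasurable
  have e2 : ∫ ω, I 2 ω * (b 0 ω * b 1 ω) ∂μ = (∫ ω, I 2 ω ∂μ) * ∫ ω, b 0 ω * b 1 ω ∂μ :=
    (hindep 2 fun q => t ^ q.1 * t ^ q.2).integral_fun_mul_eq_mul_integral
      (hIm 2).aestronglyMeasurable ((hbm 0).mul (hbm 1)).aestronglyMeasurable
  have e3 : ∫ ω, b 0 ω * b 1 ω ∂μ = (∫ ω, b 0 ω ∂μ) * ∫ ω, b 1 ω ∂μ :=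
    ((hm.indepFun_children n).comp hpow hpow).integral_fun_mul_eq_mul_integral
      (hbm 0).aestronglyMeasurable (hbm 1).aestronglyMeasurable
  have e4 : ∫ ω, I 0 ω + I 1 ω * b 0 ω + I 2 ω * (b 0 ω * b 1 ω) ∂μ
      = (∫ ω, I 0 ω + I 1 ω * b 0 ω ∂μ) + ∫ ω, I 2 ω * (b 0 ω * b 1 ω) ∂μ :=
    integral_add (hi0.add hi1) hi2
  rw [e4, integral_add hi0 hi1, e1, e2, e3, hIint, hIint, hIint,
    hbint, hbint, hm.offspring_zero, hm.offspring_one, hm.offspring_two]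
  ring

include hX

theorem integral_pow_toNat_eq_eta (t : ℝ) :
    ∫ ω, t ^ (X [] ω + 1).toNat ∂μ = eta μ (X []) t := by
  refine integral_congr_ae ?_
  filter_upwards [hX] with ω hω
  rw [← zpow_natCast, Int.toNat_of_nonneg (by omega)]

theorem eta_zero : eta μ (X []) 0 = 1 - probNonneg μ (X []) := by
  have hms : MeasurableSet {ω | 0 ≤ X [] ω} :=
    measurableSet_le measurable_const (hm.measurable_contribution [])
  rw [← hm.integral_pow_toNat_eq_eta hX, probNonneg, ← probReal_compl_eq_one_sub hms,
    ← integral_indicator_one hms.compl]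
  refine integral_congr_ae ?_
  filter_upwards [hX] with ω hω
  by_cases h : 0 ≤ X [] ω
  · simp [h, show ¬ X [] ω + 1 ≤ 0 by omega]
  · simp [h, show X [] ω + 1 = 0 by omega]

/-- Up to a correction, `t · t^((X+S) ∨ 0)` equals `t^(X+1) t^S`. The correction is supported on `X
= -1, S = 0`, whose indicator is `0^(X+1) 0^S`; hence `integral_pow_contribution_mul` is used at
both `t` and `0`. -/
theorem truncated_functional_equation {t : ℝ} (ht : t ∈ Icc (0 : ℝ) 1) (n : ℕ) :
    t * ∫ ω, t ^ truncValue Z X (n + 1) [] ω ∂μ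
      = eta μ (X []) t * ((1 + ∫ ω, t ^ truncValue Z X n [] ω ∂μ) / 2) ^ 2
        - (1 - probNonneg μ (X [])) *
          ((1 + ∫ ω, (0 : ℝ) ^ truncValue Z X n [] ω ∂μ) / 2) ^ 2 * (1 - t) := by
  have hint : ∀ s ∈ Icc (0 : ℝ) 1, Integrable (fun ω => s ^ (X [] ω + 1).toNat *
      s ^ (∑ i ∈ Finset.range (Z [] ω), truncValue Z X n [i] ω)) μ := fun s hs => by
    refine .of_bound (Measurable.aestronglyMeasurable ?_) 1 (ae_of_all _ fun ω => ?_)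
    · have hS : Measurable fun ω => ∑ i ∈ Finset.range (Z [] ω), (truncValue Z X n [i] ω : ℤ) :=
        measurable_sum_range (hm.measurable_offspring []) fun i =>
          (measurable_of_countable _).comp (hm.measurable_truncValue n [i])
      have h2 : Measurable fun q : ℤ × ℤ => s ^ (q.1 + 1).toNat * s ^ q.2.toNat :=
        measurable_of_countable _
      have h3 := h2.comp ((hm.measurable_contribution []).prodMk hS)
      simpa only [Function.comp_def, ← Nat.cast_sum, Int.toNat_natCast] using h3
    · rw [← pow_add, Real.norm_of_nonneg (pow_nonneg hs.1 _)]
      exact pow_le_one₀ hs.1 hs.2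
  have h0 : (0 : ℝ) ∈ Icc (0 : ℝ) 1 := ⟨le_rfl, zero_le_one⟩
  rw [← hm.eta_zero hX, ← hm.integral_pow_toNat_eq_eta hX t, ← hm.integral_pow_toNat_eq_eta hX 0,
    ← hm.integral_pow_contribution_mul ht, ← hm.integral_pow_contribution_mul h0,
    ← integral_const_mul, ← integral_mul_const,
    ← integral_sub (hint t ht) ((hint 0 h0).mul_const _)]
  refine integral_congr_ae ?_
  filter_upwards [hX] with ω hω
  set S := ∑ i ∈ Finset.range (Z [] ω), truncValue Z X n [i] ω with hS
  have hW : truncValue Z X (n + 1) [] ω = (X [] ω + S).toNat := by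
    rw [truncValue, truncRunoff, hS]
    push_cast
    simp only [natCast_truncValue, List.nil_append]
    omega
  rw [hW]
  -- Since `X ≥ -1` and `S ≥ 0`, this is the only case where the positive part acts, and it forces
  -- `X = -1` and `S = 0`.
  by_cases h : X [] ω + S = -1
  · have h1 : X [] ω = -1 := by omega
    have h2 : S = 0 := by omega
    simp [h1, h2]
  · have h1 : (X [] ω + S).toNat + 1 = (X [] ω + 1).toNat + S := by omega
    have h2 : (0 : ℝ) ^ ((X [] ω + 1).toNat + S) = 0 := zero_pow (by omega)
    rw [← pow_add, ← pow_add, h2, ← pow_succ', h1]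
    ring

theorem tendsto_integral_pow_truncValue {t : ℝ} (ht : t ∈ Ico (0 : ℝ) 1) :
    Tendsto (fun n => ∫ ω, t ^ truncValue Z X n [] ω ∂μ) atTop (𝓝 (runoffGF μ Z X t)) := by
  rw [funext fun n => integral_pow_eq_one_sub (hm.measurable_truncValue n []) ht]
  refine (Tendsto.const_mul _ ?_).const_sub 1
  refine tendsto_tsum_of_dominated_convergence (summable_geometric_of_lt_one ht.1 ht.2)
    (fun k => (tendsto_tail_trunc k).mul_const _) (Eventually.of_forall fun n k => ?_)
  rw [Real.norm_of_nonneg (mul_nonneg measureReal_nonneg (pow_nonneg ht.1 k))]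
  exact mul_le_of_le_one_left (pow_nonneg ht.1 k) measureReal_le_one

/-- The functional equation for the generating function of the root runoff. -/
theorem functional_equation {t : ℝ} (ht : t ∈ Ico (0 : ℝ) 1) :
    t * runoffGF μ Z X t
      = eta μ (X []) t * ((1 + runoffGF μ Z X t) / 2) ^ 2
        - (1 - probNonneg μ (X [])) * ((1 + runoffGF μ Z X 0) / 2) ^ 2 * (1 - t) := by
  have h := hm.tendsto_integral_pow_truncValue hX ht
  have h0 := hm.tendsto_integral_pow_truncValue hX (t := 0) ⟨le_rfl, zero_lt_one⟩
  refine tendsto_nhds_unique (((tendsto_add_atTop_iff_nat 1).2 h).const_mul t) ?_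
  rw [funext fun n => hm.truncated_functional_equation hX (Ico_subset_Icc_self ht) n]
  exact ((((h.const_add 1).div_const 2).pow 2).const_mul _).sub
    (((((h0.const_add 1).div_const 2).pow 2).const_mul _).mul_const _)

end
end IsBGWRunoffModel

end Recursion

/-! ### Taylor expansion by iterated difference quotients -/

section Taylor

theorem analyticAt_dslope {f : ℝ → ℝ} {a : ℝ} (hf : AnalyticAt ℝ f a) :
    AnalyticAt ℝ (dslope f a) a := by
  obtain ⟨p, hp⟩ := hf
  exact ⟨_, hp.has_fpower_series_dslope_fslope⟩

theorem eq_add_mul_dslope (f : ℝ → ℝ) (a t : ℝ) : f t = f a + (t - a) * dslope f a t := by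
  have := sub_smul_dslope f a t
  rw [smul_eq_mul] at this
  linarith

theorem iteratedDeriv_two_of_eventually_eq {f H : ℝ → ℝ} {a b c : ℝ} (hH : AnalyticAt ℝ H a)
    (hf : ∀ᶠ t in 𝓝 a, f t = c + b * (t - a) + (t - a) ^ 2 * H t) :
    iteratedDeriv 2 f a = 2 * H a := by
  have h1 : ∀ᶠ t in 𝓝 a, deriv f t = b + (2 * (t - a) * H t + (t - a) ^ 2 * deriv H t) := by
    filter_upwards [hf.eventually_nhds, hH.eventually_analyticAt] with t ht hHt
    rw [Filter.EventuallyEq.deriv_eq ht]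
    have hd : HasDerivAt (fun x : ℝ => x - a) 1 t := (hasDerivAt_id t).sub_const a
    have := (((hd.const_mul b).const_add c).add
      ((hd.pow 2).mul hHt.differentiableAt.hasDerivAt)).deriv
    refine this.trans ?_
    simp
  rw [iteratedDeriv_succ, iteratedDeriv_one, Filter.EventuallyEq.deriv_eq h1]
  have hd : HasDerivAt (fun x : ℝ => x - a) 1 a := (hasDerivAt_id a).sub_const a
  have := ((((hd.const_mul 2).mul hH.differentiableAt.hasDerivAt).add
    ((hd.pow 2).mul hH.deriv.differentiableAt.hasDerivAt)).const_add b).deriv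
  refine this.trans ?_
  simp

theorem one_add_pow_ge_quadratic {u : ℝ} (hu : 0 ≤ u) (n : ℕ) :
    1 + n * u + n * (n - 1) / 2 * u ^ 2 ≤ (1 + u) ^ n := by
  induction n with
  | zero => simp
  | succ n ih =>
    have h1 := mul_le_mul_of_nonneg_right ih (by linarith : 0 ≤ 1 + u)
    have h2 : 0 ≤ (n : ℝ) * (n - 1) / 2 * u ^ 3 := by
      rcases Nat.eq_zero_or_pos n with rfl | hn
      · simp
      · have : (1 : ℝ) ≤ n := Nat.one_le_cast.2 hn
        have : 0 ≤ (n : ℝ) - 1 := by linarith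
        positivity
    rw [pow_succ (1 + u)]
    push_cast
    linarith

end Taylor

/-! ### Analyticity of `η` and expansion of `h` at `1` -/

section Eta

variable {Ω : Type*} [MeasurableSpace Ω] {μ : Measure Ω} [IsProbabilityMeasure μ] {X : Ω → ℤ}

/-- The variable `X + 1` as a real random variable. -/
def shifted (X : Ω → ℤ) (ω : Ω) : ℝ := (X ω : ℝ) + 1

theorem zpow_eq_exp_shifted {t : ℝ} (ht : 0 < t) (ω : Ω) :
    t ^ (X ω + 1) = Real.exp (Real.log t * shifted X ω) := by
  rw [← Real.rpow_intCast, Real.rpow_def_of_pos ht, shifted]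
  push_cast
  rfl

theorem eta_eq_mgf {t : ℝ} (ht : 0 < t) : eta μ X t = mgf (shifted X) μ (Real.log t) := by
  simp only [eta, mgf, zpow_eq_exp_shifted ht]

theorem measurable_shifted (hXm : Measurable X) : Measurable (shifted X) :=
  ((measurable_of_countable (fun k : ℤ => (k : ℝ))).comp hXm).add_const 1

variable (hXm : Measurable X) (hX : ∀ᵐ ω ∂μ, -1 ≤ X ω)
  (hη : ∀ᶠ t in 𝓝 (1 : ℝ), Integrable (fun ω => t ^ (X ω + 1)) μ)

include hXm hX hη

/-- As `X + 1 ≥ 0`, every nonpositive exponent is integrable. Finiteness of `η` at one point beyond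
`1` adds a positive exponent, and convexity fills the gap, leaving `0` in the interior. -/
theorem mem_interior_integrableExpSet {s : ℝ} (hs : s ≤ 0) :
    s ∈ interior (integrableExpSet (shifted X) μ) := by
  obtain ⟨t, ht, ht1⟩ := ((hη.filter_mono (nhdsWithin_le_nhds (s := Ioi 1))).and
    (eventually_mem_set.2 self_mem_nhdsWithin)).exists
  have ht1 : 1 < t := ht1
  have hlog : 0 < Real.log t := Real.log_pos ht1
  have hmem : Real.log t ∈ integrableExpSet (shifted X) μ := by
    simpa only [integrableExpSet, Set.mem_ofPred_eq, zpow_eq_exp_shifted (zero_lt_one.trans ht1)]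
      using ht
  have hneg : ∀ r ≤ 0, r ∈ integrableExpSet (shifted X) μ := fun r hr => by
    refine Integrable.of_bound (C := 1) ?_ ?_
    · exact (Real.measurable_exp.comp ((measurable_shifted hXm).const_mul r)).aestronglyMeasurable
    · filter_upwards [hX] with ω hω
      rw [Real.norm_of_nonneg (Real.exp_pos _).le, Real.exp_le_one_iff]
      refine mul_nonpos_of_nonpos_of_nonneg hr ?_
      have : (-1 : ℝ) ≤ X ω := by exact_mod_cast hω
      rw [shifted]; linarith
  refine interior_maximal (t := Iio (Real.log t)) (fun r hr => ?_) isOpen_Iio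
    (hs.trans_lt hlog)
  rcases le_total r 0 with h | h
  · exact hneg r h
  · exact convex_integrableExpSet.ordConnected.out (hneg 0 le_rfl) hmem ⟨h, (mem_Iio.1 hr).le⟩

theorem analyticAt_eta {t : ℝ} (ht : t ∈ Ioc (0 : ℝ) 1) : AnalyticAt ℝ (eta μ X) t := by
  have h1 : AnalyticAt ℝ (fun t => mgf (shifted X) μ (Real.log t)) t :=
    (analyticAt_mgf (mem_interior_integrableExpSet hXm hX hη
      (Real.log_nonpos ht.1.le ht.2))).comp (analyticAt_log ht.1)
  refine h1.congr ?_
  filter_upwards [Ioi_mem_nhds ht.1] with s hs using (eta_eq_mgf hs).symm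

theorem eta_pos {t : ℝ} (ht : t ∈ Ioc (0 : ℝ) 1) : 0 < eta μ X t := by
  rw [eta_eq_mgf ht.1]
  exact mgf_pos (interior_subset (s := integrableExpSet (shifted X) μ)
    (mem_interior_integrableExpSet hXm hX hη (Real.log_nonpos ht.1.le ht.2)))

theorem eta_one : eta μ X 1 = 1 := by simp [eta]

theorem memLp_shifted : MemLp (shifted X) 2 μ :=
  memLp_of_mem_interior_integrableExpSet (mem_interior_integrableExpSet hXm hX hη le_rfl) 2

theorem integrable_shifted : Integrable (shifted X) μ :=
  (memLp_shifted hXm hX hη).integrable one_le_two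

theorem integral_shifted : ∫ ω, shifted X ω ∂μ = 1 + mean μ X := by
  have h : Integrable (fun ω => (X ω : ℝ)) μ :=
    ((integrable_shifted hXm hX hη).sub (integrable_const 1)).congr
      (ae_of_all _ fun ω => by simp [shifted])
  simp only [shifted, mean]
  rw [integral_add h (integrable_const 1)]
  simp [add_comm]

theorem integral_shifted_sq :
    ∫ ω, shifted X ω ^ 2 ∂μ = variance (fun ω => (X ω : ℝ)) μ + (1 + mean μ X) ^ 2 := by
  have h1 : variance (shifted X) μ = variance (fun ω => (X ω : ℝ)) μ :=
    variance_add_const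
      ((measurable_of_countable (fun k : ℤ => (k : ℝ))).comp hXm).aestronglyMeasurable 1
  have h2 := variance_eq_sub (memLp_shifted hXm hX hη)
  rw [← h1, h2, integral_shifted hXm hX hη]
  simp

theorem hasDerivAt_eta_one : HasDerivAt (eta μ X) (1 + mean μ X) 1 := by
  have h0 := mem_interior_integrableExpSet hXm hX hη (le_refl 0)
  have h1 : HasDerivAt (mgf (shifted X) μ) (1 + mean μ X) (Real.log 1) := by
    rw [Real.log_one, ← integral_shifted hXm hX hη, ← deriv_mgf_zero h0]
    exact (analyticAt_mgf h0).differentiableAt.hasDerivAt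
  have h2 := h1.comp 1 (Real.hasDerivAt_log one_ne_zero)
  rw [inv_one, mul_one] at h2
  refine h2.congr_of_eventuallyEq ?_
  filter_upwards [Ioi_mem_nhds (zero_lt_one' ℝ)] with s hs using eta_eq_mgf hs

theorem iteratedDeriv_two_eta_one : iteratedDeriv 2 (eta μ X) 1
    = variance (fun ω => (X ω : ℝ)) μ + (1 + mean μ X) * mean μ X := by
  have h0 := mem_interior_integrableExpSet hXm hX hη (le_refl 0)
  have hA : AnalyticAt ℝ (mgf (shifted X) μ) (Real.log 1) := by
    rw [Real.log_one]; exact analyticAt_mgf h0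
  have h1 : ∀ᶠ t in 𝓝 (1 : ℝ), deriv (eta μ X) t = deriv (mgf (shifted X) μ) (Real.log t) * t⁻¹ := by
    have hlog : ∀ᶠ t in 𝓝 (1 : ℝ), AnalyticAt ℝ (mgf (shifted X) μ) (Real.log t) :=
      (Real.continuousAt_log one_ne_zero).eventually hA.eventually_analyticAt
    filter_upwards [Ioi_mem_nhds (zero_lt_one' ℝ), hlog] with t ht hlt
    have h2 := hlt.differentiableAt.hasDerivAt.comp t (Real.hasDerivAt_log (mem_Ioi.1 ht).ne')
    rw [← h2.deriv]
    refine Filter.EventuallyEq.deriv_eq ?_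
    filter_upwards [Ioi_mem_nhds (mem_Ioi.1 ht)] with s hs using eta_eq_mgf hs
  rw [iteratedDeriv_succ, iteratedDeriv_one, Filter.EventuallyEq.deriv_eq h1]
  have h3 := (hA.deriv.differentiableAt.hasDerivAt.comp 1 (Real.hasDerivAt_log one_ne_zero)).mul
    (hasDerivAt_inv (one_ne_zero (α := ℝ)))
  have h4 : deriv (deriv (mgf (shifted X) μ)) 0 = ∫ ω, shifted X ω ^ 2 ∂μ := by
    have := iteratedDeriv_mgf_zero h0 2
    rw [iteratedDeriv_succ, iteratedDeriv_one] at this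
    rw [this]; rfl
  refine h3.deriv.trans ?_
  simp only [Function.comp, Real.log_one, inv_one, mul_one, one_pow, mul_neg]
  rw [h4, deriv_mgf_zero h0, integral_shifted hXm hX hη, integral_shifted_sq hXm hX hη]
  ring

/-- Divides out the zero of `η(t) - t` at `1`. This cancels the factor `1 - t` in the denominator of
`h`. -/
theorem exists_eta_eq : ∃ g : ℝ → ℝ, AnalyticAt ℝ g 1 ∧ g 1 = mean μ X ∧
    ∀ t, eta μ X t = t + (t - 1) * g t := by
  refine ⟨dslope (fun t => eta μ X t - t) 1, analyticAt_dslope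
    ((analyticAt_eta hXm hX hη ⟨zero_lt_one, le_rfl⟩).sub analyticAt_id), ?_, fun t => ?_⟩
  · have := (hasDerivAt_eta_one hXm hX hη).sub (hasDerivAt_id 1)
    rw [dslope_same]
    refine this.deriv.trans ?_
    ring
  · have := eq_add_mul_dslope (fun t => eta μ X t - t) 1 t
    simp only [eta_one hXm hX hη] at this
    linarith

/-- The third order Taylor remainder of `η` at `1` is non-negative to the right of `1`. -/
theorem eta_ge_quadratic : ∀ᶠ t in 𝓝[>] (1 : ℝ),
    1 + (1 + mean μ X) * (t - 1)
      + (variance (fun ω => (X ω : ℝ)) μ + (1 + mean μ X) * mean μ X) / 2 * (t - 1) ^ 2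
        ≤ eta μ X t := by
  filter_upwards [hη.filter_mono nhdsWithin_le_nhds, self_mem_nhdsWithin] with t ht ht1
  have ht1 : 1 < t := ht1
  have hY := integrable_shifted hXm hX hη
  have hY2 : Integrable (fun ω => shifted X ω ^ 2) μ := (memLp_shifted hXm hX hη).integrable_sq
  have hq : ∫ ω, 1 + shifted X ω * (t - 1) + (shifted X ω ^ 2 - shifted X ω) / 2 * (t - 1) ^ 2 ∂μ
      = 1 + (1 + mean μ X) * (t - 1)
      + (variance (fun ω => (X ω : ℝ)) μ + (1 + mean μ X) * mean μ X) / 2 * (t - 1) ^ 2 := by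
    have e1 : Integrable (fun ω => 1 + shifted X ω * (t - 1)) μ :=
      (integrable_const _).add (hY.mul_const _)
    have e2 : Integrable (fun ω => (shifted X ω ^ 2 - shifted X ω) / 2 * (t - 1) ^ 2) μ :=
      ((hY2.sub hY).div_const 2).mul_const _
    rw [integral_add e1 e2, integral_add (integrable_const _) (hY.mul_const _),
      integral_mul_const, integral_mul_const, integral_div, integral_sub hY2 hY,
      integral_shifted hXm hX hη, integral_shifted_sq hXm hX hη]
    simp only [integral_const, probReal_univ, smul_eq_mul, mul_one]
    ring
  rw [← hq]
  refine integral_mono_ae ?_ ht ?_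
  · exact ((integrable_const _).add (hY.mul_const _)).add (((hY2.sub hY).div_const 2).mul_const _)
  · filter_upwards [hX] with ω hω
    obtain ⟨n, hn⟩ := Int.eq_ofNat_of_zero_le (show 0 ≤ X ω + 1 by omega)
    have hs : shifted X ω = n := by rw [shifted]; exact_mod_cast hn
    have := one_add_pow_ge_quadratic (sub_nonneg.2 ht1.le) n
    rw [hs, hn, zpow_natCast]
    rw [show 1 + (t - 1) = t by ring] at this
    refine le_trans (le_of_eq ?_) this
    ring

variable (hα : probNonneg μ X < 1)

include hα

/-- First and second order expansions of `h` at `1`. -/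
theorem exists_h_expansion : ∃ H₁ H₂ : ℝ → ℝ, AnalyticAt ℝ H₁ 1 ∧ AnalyticAt ℝ H₂ 1 ∧
    (∀ᶠ t in 𝓝 1, h μ X t = h μ X 1 + (t - 1) * H₁ t) ∧
    H₁ 1 = -(4 / (1 - probNonneg μ X)) *
      ((variance (fun ω => (X ω : ℝ)) μ + mean μ X * (1 - mean μ X)) / 2) ∧
    (variance (fun ω => (X ω : ℝ)) μ = -mean μ X * (1 - mean μ X) →
      (∀ᶠ t in 𝓝 1, h μ X t = h μ X 1 + (t - 1) ^ 2 * H₂ t) ∧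
      (mean μ X < 0 → H₂ 1 < 0)) := by
  obtain ⟨g, hg, hg1, hgη⟩ := exists_eta_eq hXm hX hη
  set m := mean μ X with hm
  set V := variance (fun ω => (X ω : ℝ)) μ with hV
  set C := 4 / (1 - probNonneg μ X) with hC
  have hCpos : 0 < C := div_pos (by norm_num) (by linarith)
  have hηA := analyticAt_eta hXm hX hη ⟨zero_lt_one, le_rfl⟩
  have hη1 := eta_one hXm hX hη
  have hηne : ∀ᶠ t in 𝓝 1, eta μ X t ≠ 0 :=
    hηA.continuousAt.eventually_ne (by rw [hη1]; exact one_ne_zero)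
  -- `g 1`, `g₂ 1` and `g₃ 1` are the Taylor coefficients of `η(t) - t` at `1` of orders one, two
  -- and three.
  set g₂ := dslope g 1 with hg₂
  set g₃ := dslope g₂ 1 with hg₃
  have hg2A : AnalyticAt ℝ g₂ 1 := analyticAt_dslope hg
  have hg3A : AnalyticAt ℝ g₃ 1 := analyticAt_dslope hg2A
  have hgt : ∀ t, g t = m + (t - 1) * g₂ t := fun t => by rw [← hg1]; exact eq_add_mul_dslope g 1 t
  have hg2t : ∀ t, g₂ t = g₂ 1 + (t - 1) * g₃ t := fun t => eq_add_mul_dslope g₂ 1 t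
  have hg21 : g₂ 1 = (V + (1 + m) * m) / 2 := by
    have := iteratedDeriv_two_of_eventually_eq (f := eta μ X) (b := 1 + m) (c := 1) hg2A
      (Eventually.of_forall fun t => by rw [hgη t, hgt t]; ring)
    rw [iteratedDeriv_two_eta_one hXm hX hη] at this
    linarith
  -- To the right of `1`, `η` dominates its second Taylor polynomial, because each binomial
  -- `(1+u)^n` does.
  have hg31 : 0 ≤ g₃ 1 := by
    refine ge_of_tendsto (hg3A.continuousAt.tendsto.mono_left (nhdsWithin_le_nhds (s := Ioi 1))) ?_
    filter_upwards [eta_ge_quadratic hXm hX hη, self_mem_nhdsWithin] with t ht ht1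
    have ht1 : 0 < t - 1 := sub_pos.2 ht1
    rw [hgη t, hgt t, hg2t t, ← hg21] at ht
    have : 0 ≤ (t - 1) ^ 3 * g₃ t := by linarith
    exact nonneg_of_mul_nonneg_right this (by positivity)
  have hh1 : h μ X 1 = -C * m := by rw [h, if_pos rfl, hC]; ring
  have hht : ∀ t, h μ X t = -C * (t * g t / eta μ X t) := fun t => by
    by_cases ht : t = 1
    · rw [ht, hh1, hη1, hg1]; ring
    · rw [h, if_neg ht, ← hC, hgη t]
      have h1 : 1 - t ≠ 0 := sub_ne_zero.2 (Ne.symm ht)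
      rw [show t * (t + (t - 1) * g t - t) = (1 - t) * (-(t * g t)) by ring,
        mul_div_mul_left _ _ h1]
      ring
  have hexp : ∀ t, eta μ X t ≠ 0 →
      h μ X t = h μ X 1 + (t - 1) * (-C * ((t * g₂ t - m * g t) / eta μ X t)) := fun t ht => by
    rw [hht, hh1]
    field_simp
    rw [hgη t, hgt t]; ring
  refine ⟨fun t => -C * ((t * g₂ t - m * g t) / eta μ X t),
    fun t => -C * ((m ^ 2 + t * g₃ t - m * g₂ t) / eta μ X t), ?_, ?_, ?_, ?_, ?_⟩
  · exact analyticAt_const.mul (((analyticAt_id.mul hg2A).sub (analyticAt_const.mul hg)).div hηA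
      (by rw [hη1]; exact one_ne_zero))
  · exact analyticAt_const.mul (((analyticAt_const.add (analyticAt_id.mul hg3A)).sub
      (analyticAt_const.mul hg2A)).div hηA (by rw [hη1]; exact one_ne_zero))
  · exact hηne.mono hexp
  · simp only [hη1, hg1, hg21]; ring
  · intro hVm
    -- The critical variance makes `t g₂ - m g` vanish at `1`, so a second factor `t - 1` comes out.
    -- What remains has value `m² + g₃(1) - m³` at `1`, positive when `m < 0`.
    have hm2 : g₂ 1 = m ^ 2 := by rw [hg21, hVm]; ring
    refine ⟨hηne.mono fun t ht => ?_, fun hm0 => ?_⟩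
    · have hB := hg2t t
      rw [hm2] at hB
      have e : t * g₂ t - m * g t = (t - 1) * (m ^ 2 + t * g₃ t - m * g₂ t) := by
        linear_combination (-m) * hgt t + t * hB
      rw [hexp t ht, e]
      ring
    · simp only [hη1, hm2, div_one, one_mul]
      have h1 : 0 < m ^ 2 := by nlinarith
      have h2 : 0 < m ^ 2 * (-m) := mul_pos h1 (by linarith)
      have : 0 < m ^ 2 + g₃ 1 - m * m ^ 2 := by nlinarith
      nlinarith

theorem continuousAt_h_one : ContinuousAt (h μ X) 1 := by
  obtain ⟨H₁, -, h1, -, h2, -⟩ := exists_h_expansion hXm hX hη hα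
  have : ContinuousAt (fun t => h μ X 1 + (t - 1) * H₁ t) 1 :=
    continuousAt_const.add ((by fun_prop : ContinuousAt (fun t : ℝ => t - 1) 1).mul h1.continuousAt)
  exact this.congr (h2.mono fun t ht => ht.symm)

end Eta

/-! ### Abelian limits and generating functions of tail sums -/

section TailSums

theorem tendsto_sqrt_one_sub : Tendsto (fun t : ℝ => √(1 - t)) (𝓝[<] 1) (𝓝 0) := by
  have : Tendsto (fun t : ℝ => √(1 - t)) (𝓝 1) (𝓝 (√(1 - 1))) :=
    (by fun_prop : Continuous fun t : ℝ => √(1 - t)).tendsto 1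
  simpa using this.mono_left (nhdsWithin_le_nhds (s := Iio 1))

/-- Nonnegativity bounds each partial sum by the limit `L`; Abel's theorem then identifies the sum
with `L`. -/
theorem summable_of_tendsto_powerSeries {p : ℕ → ℝ} {L : ℝ} (hp : ∀ k, 0 ≤ p k)
    (hs : ∀ t ∈ Ioo (0 : ℝ) 1, Summable fun k => p k * t ^ k)
    (hL : Tendsto (fun t : ℝ => ∑' k, p k * t ^ k) (𝓝[<] 1) (𝓝 L)) : HasSum p L := by
  have hsum : Summable p := by
    refine summable_of_sum_range_le hp (c := L) fun n => ?_
    have h1 : Tendsto (fun t : ℝ => ∑ k ∈ Finset.range n, p k * t ^ k) (𝓝[<] 1)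
        (𝓝 (∑ k ∈ Finset.range n, p k * 1 ^ k)) :=
      ((by fun_prop : Continuous fun t : ℝ => ∑ k ∈ Finset.range n, p k * t ^ k).tendsto 1).mono_left
        nhdsWithin_le_nhds
    simp only [one_pow, mul_one] at h1
    refine le_of_tendsto_of_tendsto h1 hL ?_
    filter_upwards [Ioo_mem_nhdsLT (zero_lt_one' ℝ)] with t ht
    exact (hs t ht).sum_le_tsum _ fun k _ => mul_nonneg (hp k) (pow_nonneg ht.1.le k)
  have := Real.tendsto_tsum_powerSeries_nhdsWithin_lt hsum.hasSum.tendsto_sum_nat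
  rw [tendsto_nhds_unique hL this]
  exact hsum.hasSum

/-- The generating function of the tail sums of a summable sequence. -/
theorem one_sub_mul_tsum_tail {p : ℕ → ℝ} (hp : ∀ k, 0 ≤ p k) (hs : Summable p) {t : ℝ}
    (ht : t ∈ Ioo (0 : ℝ) 1) :
    (Summable fun k => (∑' j, p (j + (k + 1))) * t ^ k) ∧
    (1 - t) * ∑' k, (∑' j, p (j + (k + 1))) * t ^ k = ∑' k, p k - ∑' k, p k * t ^ k := by
  set T : ℕ → ℝ := fun k => ∑' j, p (j + (k + 1)) with hT
  have hgeo := summable_geometric_of_lt_one ht.1.le ht.2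
  have hTle : ∀ k, T k ≤ ∑' j, p j := fun k => by
    rw [← hs.sum_add_tsum_nat_add (k + 1)]
    have := Finset.sum_nonneg fun j (_ : j ∈ Finset.range (k + 1)) => hp j
    linarith
  have hT0 : ∀ k, 0 ≤ T k := fun k => tsum_nonneg fun j => hp _
  have hTs : Summable fun k => T k * t ^ k :=
    (hgeo.mul_left (∑' j, p j)).of_nonneg_of_le
      (fun k => mul_nonneg (hT0 k) (pow_nonneg ht.1.le k))
      fun k => mul_le_mul_of_nonneg_right (hTle k) (pow_nonneg ht.1.le k)
  have hps : Summable fun k => p k * t ^ k :=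
    hs.of_nonneg_of_le (fun k => mul_nonneg (hp k) (pow_nonneg ht.1.le k))
      fun k => mul_le_of_le_one_right (hp k) (pow_le_one₀ ht.1.le ht.2.le)
  refine ⟨hTs, ?_⟩
  have hrec : ∀ k, T k = p (k + 1) + T (k + 1) := fun k => by
    have h1 := ((summable_nat_add_iff (k + 1)).2 hs).tsum_eq_zero_add
    simp only [hT]
    rw [h1, zero_add]
    congr 1
    refine tsum_congr fun j => ?_
    congr 1; ring
  have h0 : ∑' k, p k = p 0 + T 0 := hs.tsum_eq_zero_add
  have h1 := hTs.tsum_eq_zero_add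
  have h2 := hps.tsum_eq_zero_add
  have hTs' : Summable fun k => T (k + 1) * t ^ k := by
    refine (hgeo.mul_left (∑' j, p j)).of_nonneg_of_le
      (fun k => mul_nonneg (hT0 _) (pow_nonneg ht.1.le k))
      fun k => mul_le_mul_of_nonneg_right (hTle _) (pow_nonneg ht.1.le k)
  have hps' : Summable fun k => p (k + 1) * t ^ k :=
    ((summable_nat_add_iff 1).2 hs).of_nonneg_of_le
      (fun k => mul_nonneg (hp _) (pow_nonneg ht.1.le k))
      fun k => mul_le_of_le_one_right (hp _) (pow_le_one₀ ht.1.le ht.2.le)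
  have h3 : ∑' k, T k * t ^ k = (∑' k, p (k + 1) * t ^ k) + ∑' k, T (k + 1) * t ^ k := by
    rw [← hps'.tsum_add hTs']
    exact tsum_congr fun k => by rw [← add_mul, ← hrec]
  have h4 : ∑' k, T (k + 1) * t ^ (k + 1) = t * ∑' k, T (k + 1) * t ^ k := by
    rw [← tsum_mul_left]; exact tsum_congr fun k => by rw [pow_succ]; ring
  have h5 : ∑' k, p (k + 1) * t ^ (k + 1) = t * ∑' k, p (k + 1) * t ^ k := by
    rw [← tsum_mul_left]; exact tsum_congr fun k => by rw [pow_succ]; ring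
  rw [h4, pow_zero, mul_one] at h1
  rw [h5, pow_zero, mul_one] at h2
  linear_combination h1 - t * h3 - h0 + h2

end TailSums

/-! ### The signed root and the value of `P(W = 0)` -/

section SignedRoot

variable {Ω : Type*} [MeasurableSpace Ω] {μ : Measure Ω} [IsProbabilityMeasure μ]
  {Z : List ℕ → Ω → ℕ} {X : List ℕ → Ω → ℤ}

/-- The signed root `η(t) (1 + G(t)) / 2 - t` of the discriminant of the functional equation. -/
noncomputable def signedRoot (μ : Measure Ω) (Z : List ℕ → Ω → ℕ) (X : List ℕ → Ω → ℤ)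
    (t : ℝ) : ℝ :=
  eta μ (X []) t * ((1 + runoffGF μ Z X t) / 2) - t

namespace IsBGWRunoffModel

variable (hm : IsBGWRunoffModel μ (1 / 2) Z X) (hX : ∀ᵐ ω ∂μ, -1 ≤ X [] ω)
  (hα : probNonneg μ (X []) < 1)
  (hη : ∀ᶠ t in 𝓝 (1 : ℝ), Integrable (fun ω => t ^ (X [] ω + 1)) μ)

include hm hX hα hη

/-- Multiply the functional equation by `η` and complete the square; `h` is normalised so that the
remaining terms are a multiple of `c² - h`. -/
theorem signedRoot_sq {t : ℝ} (ht : t ∈ Ioo (0 : ℝ) 1) :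
    signedRoot μ Z X t ^ 2 = (1 - t) * ((1 - probNonneg μ (X [])) * eta μ (X []) t / 4 *
      ((1 + runoffGF μ Z X 0) ^ 2 - h μ (X []) t)) := by
  have hf := hm.functional_equation hX (Ioo_subset_Ico_self ht)
  have hηt := eta_pos (hm.measurable_contribution []) hX hη (Ioo_subset_Ioc_self ht)
  have h1 : 1 - t ≠ 0 := by linarith [ht.2]
  have h2 : 1 - probNonneg μ (X []) ≠ 0 := by linarith
  have hh : (1 - t) * ((1 - probNonneg μ (X [])) * eta μ (X []) t / 4 * h μ (X []) t)
      = t * (eta μ (X []) t - t) := by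
    rw [h, if_neg ht.2.ne]
    field_simp
  rw [mul_sub, mul_sub, hh, signedRoot]
  linear_combination (-eta μ (X []) t) * hf

theorem h_le {t : ℝ} (ht : t ∈ Ioo (0 : ℝ) 1) : h μ (X []) t ≤ (1 + runoffGF μ Z X 0) ^ 2 := by
  have hsq := hm.signedRoot_sq hX hα hη ht
  have hηt := eta_pos (hm.measurable_contribution []) hX hη (Ioo_subset_Ioc_self ht)
  have h1 : 0 < 1 - t := by linarith [ht.2]
  have h2 : 0 < (1 - probNonneg μ (X [])) * eta μ (X []) t / 4 :=
    div_pos (mul_pos (by linarith) hηt) (by norm_num)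
  have h3 : 0 ≤ (1 - t) * ((1 - probNonneg μ (X [])) * eta μ (X []) t / 4 *
      ((1 + runoffGF μ Z X 0) ^ 2 - h μ (X []) t)) := hsq ▸ sq_nonneg _
  exact sub_nonneg.1 (nonneg_of_mul_nonneg_right (nonneg_of_mul_nonneg_right h3 h1) h2)

theorem tendsto_discriminant : Tendsto (fun t => (1 - probNonneg μ (X [])) * eta μ (X []) t / 4 *
      ((1 + runoffGF μ Z X 0) ^ 2 - h μ (X []) t)) (𝓝[<] 1)
      (𝓝 ((1 - probNonneg μ (X [])) / 4 *
        ((1 + runoffGF μ Z X 0) ^ 2 - h μ (X []) 1))) := by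
  have h1 := (analyticAt_eta (hm.measurable_contribution []) hX hη
    ⟨zero_lt_one, le_rfl⟩).continuousAt.tendsto
  rw [eta_one (hm.measurable_contribution []) hX hη] at h1
  have h2 := (continuousAt_h_one (hm.measurable_contribution []) hX hη hα).tendsto
  have := (((h1.const_mul (1 - probNonneg μ (X []))).div_const 4).mul
    (h2.const_sub ((1 + runoffGF μ Z X 0) ^ 2))).mono_left (nhdsWithin_le_nhds (s := Iio 1))
  rwa [mul_one] at this

theorem h_one_le : h μ (X []) 1 ≤ (1 + runoffGF μ Z X 0) ^ 2 := by
  refine le_of_tendsto ((continuousAt_h_one (hm.measurable_contribution []) hX hη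
    hα).tendsto.mono_left (nhdsWithin_le_nhds (s := Iio 1))) ?_
  filter_upwards [Ioo_mem_nhdsLT (zero_lt_one' ℝ)] with t ht using hm.h_le hX hα hη ht

/-- `G ≤ 1` gives `R ≤ η - t = (t-1)g`. For positive `R` this can be squared to `R² ≤ (1-t)² g²`,
while the hypothesis makes `R²/(1-t)` converge to a positive limit. -/
theorem not_eventually_signedRoot_pos (h1 : h μ (X []) 1 < (1 + runoffGF μ Z X 0) ^ 2) :
    ¬ ∀ᶠ t in 𝓝[<] 1, 0 < signedRoot μ Z X t := by
  intro hpos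
  obtain ⟨g, hg, -, hgη⟩ := exists_eta_eq (hm.measurable_contribution []) hX hη
  have hlim : Tendsto (fun t : ℝ => (1 - t) * g t ^ 2) (𝓝[<] 1) (𝓝 0) := by
    have h1 : Tendsto (fun t : ℝ => 1 - t) (𝓝 1) (𝓝 (1 - 1)) :=
      (by fun_prop : Continuous fun t : ℝ => 1 - t).tendsto 1
    have := (h1.mul (hg.continuousAt.tendsto.pow 2)).mono_left (nhdsWithin_le_nhds (s := Iio 1))
    simpa using this
  have hle := le_of_tendsto_of_tendsto (hm.tendsto_discriminant hX hα hη) hlim (by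
    filter_upwards [hpos, Ioo_mem_nhdsLT (zero_lt_one' ℝ)] with t hR ht
    have h1t : 0 < 1 - t := by linarith [ht.2]
    have hηt := eta_pos (hm.measurable_contribution []) hX hη (Ioo_subset_Ioc_self ht)
    have hle : signedRoot μ Z X t ≤ (t - 1) * g t := by
      have hq : runoffGF μ Z X t ≤ 1 := runoffGF_le_one (Ioo_subset_Ico_self ht)
      have : eta μ (X []) t * ((1 + runoffGF μ Z X t) / 2) ≤ eta μ (X []) t * 1 :=
        mul_le_mul_of_nonneg_left (by linarith) hηt.le
      rw [signedRoot]
      linarith [hgη t]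
    have h2 := pow_le_pow_left₀ hR.le hle 2
    rw [hm.signedRoot_sq hX hα hη ht] at h2
    refine le_of_mul_le_mul_left (h2.trans_eq ?_) h1t
    ring)
  have : 0 < (1 - probNonneg μ (X [])) / 4 * ((1 + runoffGF μ Z X 0) ^ 2 - h μ (X []) 1) :=
    mul_pos (by linarith) (by linarith)
  linarith

theorem continuousOn_signedRoot : ContinuousOn (signedRoot μ Z X) (Ioo 0 1) := by
  have h1 : ContinuousOn (eta μ (X [])) (Ioo 0 1) := fun t ht =>
    (analyticAt_eta (hm.measurable_contribution []) hX hη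
      (Ioo_subset_Ioc_self ht)).continuousAt.continuousWithinAt
  have h2 : ContinuousOn (runoffGF μ Z X) (Ioo 0 1) :=
    continuousOn_runoffGF.mono Ioo_subset_Ico_self
  exact (h1.mul ((continuousOn_const.add h2).div_const 2)).sub continuousOn_id

/-- A strict inequality keeps `R²` away from zero, so the intermediate value theorem forbids a
change of sign. -/
theorem signedRoot_sign {a : ℝ} (ha : 0 ≤ a)
    (hlt : ∀ t ∈ Ioo a 1, h μ (X []) t < (1 + runoffGF μ Z X 0) ^ 2) :
    (∀ t ∈ Ioo a 1, 0 < signedRoot μ Z X t) ∨ ∀ t ∈ Ioo a 1, signedRoot μ Z X t < 0 := by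
  by_contra! hcon
  obtain ⟨⟨t₁, ht₁, h₁⟩, t₂, ht₂, h₂⟩ := hcon
  have hsub : Ioo a 1 ⊆ Ioo 0 1 := Ioo_subset_Ioo_left ha
  obtain ⟨t, ht, h0⟩ := isPreconnected_Ioo.intermediate_value ht₁ ht₂
    ((hm.continuousOn_signedRoot hX hα hη).mono hsub) ⟨h₁, h₂⟩
  have hsq := hm.signedRoot_sq hX hα hη (hsub ht)
  have hηt := eta_pos (hm.measurable_contribution []) hX hη (Ioo_subset_Ioc_self (hsub ht))
  have : 0 < (1 - t) * ((1 - probNonneg μ (X [])) * eta μ (X []) t / 4 *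
      ((1 + runoffGF μ Z X 0) ^ 2 - h μ (X []) t)) :=
    mul_pos (by linarith [ht.2]) (mul_pos (div_pos (mul_pos (by linarith) hηt) (by norm_num))
      (sub_pos.2 (hlt t ht)))
  rw [← hsq, h0] at this
  simp at this

/-- At `t = (1-α)/4`, `η(t) ≥ η(0) = 4t` and `(1+G)/2 ≥ 1/2`, whence `R ≥ 2t - t > 0`. -/
theorem exists_signedRoot_pos : ∃ t ∈ Ioo (0 : ℝ) 1, 0 < signedRoot μ Z X t := by
  have hα0 : 0 ≤ probNonneg μ (X []) := measureReal_nonneg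
  have ht : (1 - probNonneg μ (X [])) / 4 ∈ Ioo (0 : ℝ) 1 := ⟨by linarith, by linarith⟩
  refine ⟨_, ht, ?_⟩
  set t := (1 - probNonneg μ (X [])) / 4 with htdef
  have hint : ∀ s ∈ Icc (0 : ℝ) 1, Integrable (fun ω => s ^ (X [] ω + 1).toNat) μ := fun s hs => by
    have hms : Measurable fun k : ℤ => s ^ (k + 1).toNat := measurable_of_countable _
    refine .of_bound (hms.comp (hm.measurable_contribution [])).aestronglyMeasurable 1
      (ae_of_all _ fun ω => ?_)
    rw [Real.norm_of_nonneg (pow_nonneg hs.1 _)]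
    exact pow_le_one₀ hs.1 hs.2
  have hge : 1 - probNonneg μ (X []) ≤ eta μ (X []) t := by
    rw [← hm.eta_zero hX, ← hm.integral_pow_toNat_eq_eta hX, ← hm.integral_pow_toNat_eq_eta hX]
    exact integral_mono (hint 0 ⟨le_rfl, zero_le_one⟩) (hint t (Ioo_subset_Icc_self ht))
      fun ω => pow_le_pow_left₀ le_rfl ht.1.le _
  have hq : 0 ≤ runoffGF μ Z X t := runoffGF_nonneg (Ioo_subset_Ico_self ht)
  rw [signedRoot]
  nlinarith [ht.1]

variable {t₀ : ℝ} (ht₀ : t₀ ∈ Ioc (0 : ℝ) 1)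
  (hmax : ∀ t ∈ Icc (0 : ℝ) 1, t ≠ t₀ → h μ (X []) t < h μ (X []) t₀)

include ht₀ hmax

theorem sq_one_add_runoffGF_zero : (1 + runoffGF μ Z X 0) ^ 2 = h μ (X []) t₀ := by
  have hge : h μ (X []) t₀ ≤ (1 + runoffGF μ Z X 0) ^ 2 := by
    rcases ht₀.2.lt_or_eq with h1 | h1
    · exact hm.h_le hX hα hη ⟨ht₀.1, h1⟩
    · rw [h1]; exact hm.h_one_le hX hα hη
  refine le_antisymm (not_lt.1 fun hlt => ?_) hge
  have hle : ∀ t ∈ Icc (0 : ℝ) 1, h μ (X []) t ≤ h μ (X []) t₀ := fun t ht => by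
    by_cases heq : t = t₀
    · rw [heq]
    · exact (hmax t ht heq).le
  rcases hm.signedRoot_sign hX hα hη le_rfl
    (fun t ht => (hle t (Ioo_subset_Icc_self ht)).trans_lt hlt) with hpos | hneg
  · refine hm.not_eventually_signedRoot_pos hX hα hη
      ((hle 1 ⟨zero_le_one, le_rfl⟩).trans_lt hlt) ?_
    filter_upwards [Ioo_mem_nhdsLT (zero_lt_one' ℝ)] with t ht using hpos t ht
  · obtain ⟨t, ht, hp⟩ := hm.exists_signedRoot_pos hX hα hη
    exact lt_asymm hp (hneg t ht)

theorem signedRoot_neg (h1 : t₀ < 1) : ∀ t ∈ Ioo t₀ 1, signedRoot μ Z X t < 0 := by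
  have hc := hm.sq_one_add_runoffGF_zero hX hα hη ht₀ hmax
  rcases hm.signedRoot_sign hX hα hη ht₀.1.le (fun t ht => by
    rw [hc]; exact hmax t ⟨(ht₀.1.trans ht.1).le, ht.2.le⟩ ht.1.ne') with hpos | hneg
  · refine absurd ?_ (hm.not_eventually_signedRoot_pos hX hα hη ?_)
    · filter_upwards [Ioo_mem_nhdsLT h1] with t ht using hpos t ht
    · rw [hc]; exact hmax 1 ⟨zero_le_one, le_rfl⟩ h1.ne'
  · exact hneg

theorem signedRoot_pos (h1 : t₀ = 1) : ∀ t ∈ Ioo (0 : ℝ) 1, 0 < signedRoot μ Z X t := by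
  have hc := hm.sq_one_add_runoffGF_zero hX hα hη ht₀ hmax
  rcases hm.signedRoot_sign hX hα hη le_rfl (fun t ht => by
    rw [hc]; exact hmax t (Ioo_subset_Icc_self ht) (by rw [h1]; exact ht.2.ne)) with hpos | hneg
  · exact hpos
  · obtain ⟨t, ht, hp⟩ := hm.exists_signedRoot_pos hX hα hη
    exact absurd hp (lt_asymm (hneg t ht))

end IsBGWRunoffModel

end SignedRoot

/-! ### The three regimes -/

section Regimes

variable {Ω : Type*} [MeasurableSpace Ω] {μ : Measure Ω} [IsProbabilityMeasure μ]
  {Z : List ℕ → Ω → ℕ} {X : List ℕ → Ω → ℤ}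

theorem tail_nonneg (x : ℝ) : 0 ≤ tail μ Z X x := measureReal_nonneg

theorem isEquivalent_tail {r c : ℝ} (hc : c ≠ 0)
    (h : Tendsto (fun n : ℕ => tail μ Z X n * (n : ℝ) ^ r) atTop (𝓝 c)) :
    tail μ Z X ~[atTop] fun x : ℝ => c * x ^ (-r) := by
  refine (isEquivalent_floor_of_tendsto hc h).congr_left ?_
  filter_upwards [eventually_ge_atTop 0] with x hx using (tail_eq_tail_floor hx).symm

/-- The runoff rounded up, a random variable with values in `ℕ`. -/
noncomputable def natRunoff (Z : List ℕ → Ω → ℕ) (X : List ℕ → Ω → ℤ) (ω : Ω) : ℕ :=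
  ⌈(W Z X ω).toReal⌉₊

theorem measure_W_eq_top_le (k : ℕ) : μ.real {ω | W Z X ω = ∞} ≤ tail μ Z X k :=
  measureReal_mono fun ω (hω : W Z X ω = ∞) => by
    simp only [Set.mem_ofPred_eq, hω]; exact ENNReal.ofReal_lt_top

/-- The mass at infinity lies below every tail value, and `1 - G(t)` is the average of the tail
values with geometric weights `(1-t)t^k`. So `G → 1` forces `W < ∞` almost surely. -/
theorem measure_W_eq_top_le_one_sub {t : ℝ} (ht : t ∈ Ico (0 : ℝ) 1) :
    μ.real {ω | W Z X ω = ∞} ≤ 1 - runoffGF μ Z X t := by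
  have h1 : 1 - t ≠ 0 := by linarith [ht.2]
  have hgeo := summable_geometric_of_lt_one ht.1 ht.2
  have h2 : ∑' k : ℕ, μ.real {ω | W Z X ω = ∞} * t ^ k ≤ ∑' k : ℕ, tail μ Z X k * t ^ k :=
    (hgeo.mul_left _).tsum_le_tsum (fun k => mul_le_mul_of_nonneg_right (measure_W_eq_top_le k)
      (pow_nonneg ht.1 k)) (summable_tail ht)
  rw [tsum_mul_left, tsum_geometric_of_lt_one ht.1 ht.2] at h2
  have h3 := mul_le_mul_of_nonneg_left h2 (by linarith [ht.2] : 0 ≤ 1 - t)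
  rw [mul_left_comm, mul_inv_cancel₀ h1, mul_one] at h3
  rw [runoffGF]; linarith

theorem ae_W_lt_top (h : Tendsto (runoffGF μ Z X) (𝓝[<] 1) (𝓝 1)) : ∀ᵐ ω ∂μ, W Z X ω < ∞ := by
  have h0 : μ.real {ω | W Z X ω = ∞} ≤ 1 - 1 := by
    refine ge_of_tendsto (h.const_sub 1) ?_
    filter_upwards [Ioo_mem_nhdsLT (zero_lt_one' ℝ)] with t ht
    exact measure_W_eq_top_le_one_sub (Ioo_subset_Ico_self ht)
  have h1 : μ {ω | W Z X ω = ∞} = 0 := by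
    rw [sub_self] at h0
    exact (measureReal_eq_zero_iff).1 (le_antisymm h0 measureReal_nonneg)
  filter_upwards [compl_mem_ae_iff.2 h1] with ω hω
  exact lt_top_iff_ne_top.2 hω

/-- The substitution `t = e^s` turns `Φ` into a smooth extension of the Laplace transform of
`natRunoff` through `0`. -/
theorem lintegral_W_rpow_lt_top (hmW : Measurable (W Z X)) {Φ : ℝ → ℝ} (hΦ : AnalyticAt ℝ Φ 1)
    (hΦ1 : Φ 1 = 1) (hG : ∀ᶠ t in 𝓝[<] 1, runoffGF μ Z X t = Φ t) {p : ℝ} (hp : 0 < p) :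
    ∫⁻ ω, W Z X ω ^ p ∂μ < ∞ := by
  have hlim : Tendsto (runoffGF μ Z X) (𝓝[<] 1) (𝓝 1) := by
    have h1 := hΦ.continuousAt.tendsto.mono_left (nhdsWithin_le_nhds (s := Iio 1))
    rw [hΦ1] at h1
    exact h1.congr' (hG.mono fun t ht => ht.symm)
  have hfin := ae_W_lt_top hlim
  have hN : Measurable (natRunoff Z X) := Nat.measurable_ceil.comp hmW.ennreal_toReal
  have htail : ∀ k : ℕ, μ.real {ω | k < natRunoff Z X ω} = tail μ Z X k := fun k => by
    refine measureReal_congr ?_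
    filter_upwards [hfin] with ω hω
    refine propext ?_
    change k < natRunoff Z X ω ↔ ENNReal.ofReal (k : ℝ) < W Z X ω
    rw [natRunoff, Nat.lt_ceil, ENNReal.ofReal_lt_iff_lt_toReal (Nat.cast_nonneg k) hω.ne]
  have hmgf : ∀ᶠ s in 𝓝[<] (0 : ℝ), mgf (fun ω => (natRunoff Z X ω : ℝ)) μ s
      = (Φ ∘ Real.exp) s := by
    have hexp : Tendsto Real.exp (𝓝[<] 0) (𝓝[<] 1) := by
      refine tendsto_nhdsWithin_iff.2 ⟨?_, ?_⟩
      · simpa using (Real.continuous_exp.tendsto 0).mono_left (nhdsWithin_le_nhds (s := Iio 0))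
      · filter_upwards [self_mem_nhdsWithin] with s hs using Real.exp_lt_one_iff.2 hs
    filter_upwards [hexp.eventually hG, self_mem_nhdsWithin] with s hs hs0
    rw [Function.comp, ← hs, runoffGF, ← funext fun k => congrArg (· * Real.exp s ^ k) (htail k)]
    rw [← integral_pow_eq_one_sub hN ⟨(Real.exp_pos s).le, Real.exp_lt_one_iff.2 hs0⟩, mgf]
    refine integral_congr_ae (ae_of_all _ fun ω => ?_)
    simp only
    rw [mul_comm, Real.exp_nat_mul]
  have hΦ0 : AnalyticAt ℝ (Φ ∘ Real.exp) 0 := by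
    refine AnalyticAt.comp ?_ analyticAt_rexp
    rwa [Real.exp_zero]
  have hmom := lintegral_pow_lt_top_of_mgf_eqOn hN hΦ0 hmgf ⌈p⌉₊
  refine lt_of_le_of_lt (lintegral_mono_ae (g := fun ω => 1 + (natRunoff Z X ω : ℝ≥0∞) ^ ⌈p⌉₊) ?_) ?_
  · filter_upwards [hfin] with ω hω
    have hle : W Z X ω ≤ (natRunoff Z X ω : ℝ≥0∞) := by
      rw [← ENNReal.ofReal_toReal hω.ne, ← ENNReal.ofReal_natCast]
      exact ENNReal.ofReal_le_ofReal (Nat.le_ceil _)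
    refine (ENNReal.rpow_le_rpow hle hp.le).trans ?_
    rcases Nat.eq_zero_or_pos (natRunoff Z X ω) with h0 | h0
    · rw [h0, Nat.cast_zero, ENNReal.zero_rpow_of_pos hp]; exact zero_le
    · refine le_trans ?_ (le_add_of_nonneg_left zero_le)
      rw [← ENNReal.rpow_natCast]
      exact ENNReal.rpow_le_rpow_of_exponent_le (by exact_mod_cast h0) (Nat.le_ceil p)
  · rw [lintegral_add_left measurable_const]
    exact ENNReal.add_lt_top.2 ⟨by simp, hmom⟩

namespace IsBGWRunoffModel

variable (hm : IsBGWRunoffModel μ (1 / 2) Z X) (hX : ∀ᵐ ω ∂μ, -1 ≤ X [] ω)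
  (hα : probNonneg μ (X []) < 1)
  (hη : ∀ᶠ t in 𝓝 (1 : ℝ), Integrable (fun ω => t ^ (X [] ω + 1)) μ)
  {t₀ : ℝ} (ht₀ : t₀ ∈ Ioc (0 : ℝ) 1)
  (hmax : ∀ t ∈ Icc (0 : ℝ) 1, t ≠ t₀ → h μ (X []) t < h μ (X []) t₀)

include hm hX hη in
theorem runoffGF_eq {t : ℝ} (ht : t ∈ Ioo (0 : ℝ) 1) :
    runoffGF μ Z X t = 2 * (signedRoot μ Z X t + t) / eta μ (X []) t - 1 := by
  have hηt := eta_pos (hm.measurable_contribution []) hX hη (Ioo_subset_Ioc_self ht)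
  rw [signedRoot]
  field_simp
  ring

include hm hX hη in
theorem tsum_tail_eq {g : ℝ → ℝ} (hg : ∀ t, eta μ (X []) t = t + (t - 1) * g t) {t : ℝ}
    (ht : t ∈ Ioo (0 : ℝ) 1) :
    ∑' k : ℕ, tail μ Z X k * t ^ k
      = 2 * (-g t - signedRoot μ Z X t / (1 - t)) / eta μ (X []) t := by
  have hηt := eta_pos (hm.measurable_contribution []) hX hη (Ioo_subset_Ioc_self ht)
  have h1 : 1 - t ≠ 0 := by linarith [ht.2]
  have h2 := hm.runoffGF_eq hX hη ht
  rw [runoffGF] at h2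
  have h3 : (1 - t) * ∑' k : ℕ, tail μ Z X k * t ^ k
      = 2 - 2 * (signedRoot μ Z X t + t) / eta μ (X []) t := by linarith
  refine mul_left_cancel₀ h1 (h3.trans ?_)
  field_simp
  rw [hg t]; ring

include hm hX hα hη ht₀ hmax

theorem signedRoot_sq_eq {t : ℝ} (ht : t ∈ Ioo (0 : ℝ) 1) :
    signedRoot μ Z X t ^ 2 = (1 - t) * ((1 - probNonneg μ (X [])) * eta μ (X []) t / 4 *
      (h μ (X []) t₀ - h μ (X []) t)) := by
  rw [hm.signedRoot_sq hX hα hη ht, hm.sq_one_add_runoffGF_zero hX hα hη ht₀ hmax]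

theorem supercritical (h1 : t₀ < 1) :
    tail μ Z X ~[atTop] fun x : ℝ =>
        √((h μ (X []) t₀ - h μ (X []) 1) * (1 - probNonneg μ (X [])) / Real.pi)
          * x ^ (-(1 / 2) : ℝ) := by
  obtain ⟨g, hgA, -, hgη⟩ := exists_eta_eq (hm.measurable_contribution []) hX hη
  have hηA := analyticAt_eta (hm.measurable_contribution []) hX hη ⟨zero_lt_one, le_rfl⟩
  have hη1 := eta_one (hm.measurable_contribution []) hX hη
  have hΔ : 0 < h μ (X []) t₀ - h μ (X []) 1 :=
    sub_pos.2 (hmax 1 ⟨zero_le_one, le_rfl⟩ h1.ne')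
  have hα' : 0 < 1 - probNonneg μ (X []) := sub_pos.2 hα
  set K : ℝ → ℝ := fun t => (1 - probNonneg μ (X [])) * eta μ (X []) t / 4 *
      (h μ (X []) t₀ - h μ (X []) t) with hK
  have hKlim : Tendsto K (𝓝[<] 1) (𝓝 ((1 - probNonneg μ (X [])) / 4 *
      (h μ (X []) t₀ - h μ (X []) 1))) := by
    have := hm.tendsto_discriminant hX hα hη
    rwa [hm.sq_one_add_runoffGF_zero hX hα hη ht₀ hmax] at this
  have hlim : Tendsto (fun t => (1 - t) ^ (1 / 2 : ℝ) * ∑' k : ℕ, tail μ Z X k * t ^ k) (𝓝[<] 1)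
      (𝓝 (2 * (-(0 * g 1) + √((1 - probNonneg μ (X [])) / 4 *
      (h μ (X []) t₀ - h μ (X []) 1))) / 1)) := by
    have hgl := hgA.continuousAt.tendsto.mono_left (nhdsWithin_le_nhds (s := Iio 1))
    have hηl := hηA.continuousAt.tendsto.mono_left (nhdsWithin_le_nhds (s := Iio 1))
    rw [hη1] at hηl
    refine ((((tendsto_sqrt_one_sub.mul hgl).neg.add hKlim.sqrt).const_mul 2).div hηl
      one_ne_zero).congr' ?_
    filter_upwards [Ioo_mem_nhdsLT h1] with t ht
    have ht' : t ∈ Ioo (0 : ℝ) 1 := ⟨ht₀.1.trans ht.1, ht.2⟩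
    have h1t : 0 < 1 - t := by linarith [ht.2]
    -- The negative root is the one that does not cancel: it gives the tail series a positive
    -- singular term of order `(1-t)^(-1/2)`.
    have hR : signedRoot μ Z X t = -(√(1 - t) * √(K t)) := by
      rw [← Real.sqrt_mul h1t.le, ← hm.signedRoot_sq_eq hX hα hη ht₀ hmax ht',
        Real.sqrt_sq_eq_abs, abs_of_neg (hm.signedRoot_neg hX hα hη ht₀ hmax h1 t ht), neg_neg]
    rw [hm.tsum_tail_eq hX hη hgη ht', hR, ← Real.sqrt_eq_rpow]
    have hs : √(1 - t) ^ 2 = 1 - t := Real.sq_sqrt h1t.le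
    have hs0 : √(1 - t) ≠ 0 := (Real.sqrt_pos.2 h1t).ne'
    have hηt := (eta_pos (hm.measurable_contribution []) hX hη (Ioo_subset_Ioc_self ht')).ne'
    have : -(√(1 - t) * √(K t)) / (1 - t) = -(√(K t) / √(1 - t)) := by
      nth_rewrite 2 [← hs]
      field_simp
    simp only [Pi.div_apply, this]
    field_simp
    ring
  have hkar := tendsto_coeff_of_antitone (by norm_num) (by norm_num) (fun k => tail_nonneg _)
    antitone_tail (fun t ht => summable_tail (Ioo_subset_Ico_self ht)) hlim
  have hc : 2 * (-(0 * g 1) + √((1 - probNonneg μ (X [])) / 4 *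
      (h μ (X []) t₀ - h μ (X []) 1))) / 1 * (Real.Gamma (1 / 2))⁻¹
      = √((h μ (X []) t₀ - h μ (X []) 1) * (1 - probNonneg μ (X [])) / Real.pi) := by
    rw [Real.Gamma_one_half_eq, ← Real.sqrt_inv, zero_mul, neg_zero, zero_add, div_one,
      mul_assoc, ← Real.sqrt_mul (by positivity)]
    nth_rewrite 1 [show (2 : ℝ) = √4 by rw [show (4 : ℝ) = 2 ^ 2 by norm_num]; simp]
    rw [← Real.sqrt_mul (by norm_num)]
    congr 1
    ring
  rw [hc, show (1 - 1 / 2 : ℝ) = 1 / 2 by norm_num] at hkar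
  exact isEquivalent_tail (Real.sqrt_pos.2 (by positivity)).ne' hkar

/-- Since `h(0) = 0`, strict maximality at `1` gives `h(1) > 0`. -/
theorem mean_neg (h1 : t₀ = 1) : mean μ (X []) < 0 := by
  have h0 := hmax 0 ⟨le_rfl, zero_le_one⟩ (by rw [h1]; exact zero_ne_one)
  rw [h1, h, h, if_neg zero_ne_one, if_pos rfl] at h0
  simp only [zero_mul, zero_div, mul_zero] at h0
  rw [div_pos_iff_of_pos_right (sub_pos.2 hα)] at h0
  linarith

theorem subcritical (h1 : t₀ = 1)
    (hV : variance (fun ω => (X [] ω : ℝ)) μ < -mean μ (X []) * (1 - mean μ (X []))) {p : ℝ}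
    (hp : 0 < p) : ∫⁻ ω, W Z X ω ^ p ∂μ < ∞ := by
  obtain ⟨H₁, -, hH, -, hh, hH1, -⟩ :=
    exists_h_expansion (hm.measurable_contribution []) hX hη hα
  have hηA := analyticAt_eta (hm.measurable_contribution []) hX hη ⟨zero_lt_one, le_rfl⟩
  have hη1 := eta_one (hm.measurable_contribution []) hX hη
  have hα' : 0 < 1 - probNonneg μ (X []) := sub_pos.2 hα
  set B : ℝ → ℝ := fun t => (1 - probNonneg μ (X [])) * eta μ (X []) t / 4 * H₁ t with hB
  have hBA : AnalyticAt ℝ B 1 := ((analyticAt_const.mul hηA).div_const).mul hH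
  have hB1 : 0 < B 1 := by
    have : 0 < H₁ 1 := by
      rw [hH1, neg_mul, neg_pos]
      exact mul_neg_of_pos_of_neg (by positivity) (by linarith)
    simp only [hB, hη1]
    positivity
  -- The factor `exp(log B / 2)` is `√B`, written so that analyticity at `1` follows from `B 1 > 0`.
  refine lintegral_W_rpow_lt_top hm.measurable_W (Φ := fun t => 2 * ((1 - t) *
    Real.exp (Real.log (B t) / 2) + t) / eta μ (X []) t - 1) ?_ ?_ ?_ hp
  · refine AnalyticAt.sub (AnalyticAt.div (analyticAt_const.mul
      (((analyticAt_const.sub analyticAt_id).mul (AnalyticAt.rexp' ?_)).add analyticAt_id)) hηA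
      (by rw [hη1]; exact one_ne_zero)) analyticAt_const
    exact (hBA.log hB1).div_const
  · simp only [hη1]; norm_num
  · filter_upwards [Ioo_mem_nhdsLT (zero_lt_one' ℝ), hh.filter_mono nhdsWithin_le_nhds,
      (hBA.continuousAt.eventually_const_lt hB1).filter_mono nhdsWithin_le_nhds] with t ht hht hBt
    have h1t : 0 < 1 - t := by linarith [ht.2]
    have hR : signedRoot μ Z X t = (1 - t) * Real.exp (Real.log (B t) / 2) := by
      have hsq : signedRoot μ Z X t ^ 2 = ((1 - t) * Real.exp (Real.log (B t) / 2)) ^ 2 := by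
        rw [hm.signedRoot_sq_eq hX hα hη ht₀ hmax ht, h1, hht, mul_pow, ← Real.exp_nat_mul]
        rw [show ((2 : ℕ) : ℝ) * (Real.log (B t) / 2) = Real.log (B t) by push_cast; ring,
          Real.exp_log hBt]
        simp only [hB]
        ring
      exact (pow_left_inj₀ (hm.signedRoot_pos hX hα hη ht₀ hmax h1 t ht).le
        (by positivity) two_ne_zero).1 hsq
    rw [hm.runoffGF_eq hX hη ht, hR]

theorem critical (h1 : t₀ = 1)
    (hV : variance (fun ω => (X [] ω : ℝ)) μ = -mean μ (X []) * (1 - mean μ (X []))) :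
    tail μ Z X ~[atTop] fun x : ℝ =>
        √(-(iteratedDeriv 2 (h μ (X [])) 1) * (1 - probNonneg μ (X [])) / (8 * Real.pi))
          * x ^ (-(3 / 2) : ℝ) := by
  obtain ⟨-, H₂, -, hH, -, -, hcrit⟩ :=
    exists_h_expansion (hm.measurable_contribution []) hX hη hα
  obtain ⟨hh, hneg⟩ := hcrit hV
  replace hneg := hneg (hm.mean_neg hX hα hη ht₀ hmax h1)
  have hh2 : iteratedDeriv 2 (h μ (X [])) 1 = 2 * H₂ 1 :=
    iteratedDeriv_two_of_eventually_eq (b := 0) (c := h μ (X []) 1) hH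
      (hh.mono fun t ht => by rw [ht]; ring)
  obtain ⟨g, hgA, hg1, hgη⟩ := exists_eta_eq (hm.measurable_contribution []) hX hη
  have hηA := analyticAt_eta (hm.measurable_contribution []) hX hη ⟨zero_lt_one, le_rfl⟩
  have hη1 := eta_one (hm.measurable_contribution []) hX hη
  have hα' : 0 < 1 - probNonneg μ (X []) := sub_pos.2 hα
  set m := mean μ (X []) with hmdef
  set S : ℝ → ℝ := fun t => (1 - probNonneg μ (X [])) * eta μ (X []) t / 4 * (-H₂ t) with hS
  set S₁ := (1 - probNonneg μ (X [])) / 4 * (-H₂ 1) with hS₁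
  have hS1 : S 1 = S₁ := by simp only [hS, hS₁, hη1, mul_one]
  have hS1pos : 0 < S₁ := mul_pos (by positivity) (by linarith)
  have hSA : AnalyticAt ℝ S 1 := ((analyticAt_const.mul hηA).div_const).mul hH.neg
  have hSl : Tendsto (fun t => √(S t)) (𝓝[<] 1) (𝓝 √S₁) := by
    have := (hSA.continuousAt.tendsto.mono_left (nhdsWithin_le_nhds (s := Iio 1))).sqrt
    rwa [hS1] at this
  have hηl := hηA.continuousAt.tendsto.mono_left (nhdsWithin_le_nhds (s := Iio 1))
  rw [hη1] at hηl
  set f : ℝ → ℝ := fun t => g t / eta μ (X []) t with hf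
  have hfA : AnalyticAt ℝ f 1 := hgA.div hηA (by rw [hη1]; exact one_ne_zero)
  have hf1 : f 1 = m := by simp only [hf, hη1, hg1, div_one]
  have hfl := hfA.continuousAt.tendsto.mono_left (nhdsWithin_le_nhds (s := Iio 1))
  rw [hf1] at hfl
  have hQ : ∀ᶠ t in 𝓝[<] (1 : ℝ), ∑' k : ℕ, tail μ Z X k * t ^ k
      = -2 * f t - √(1 - t) * (2 * √(S t) / eta μ (X []) t) := by
    filter_upwards [Ioo_mem_nhdsLT (zero_lt_one' ℝ), hh.filter_mono nhdsWithin_le_nhds]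
      with t ht hht
    have h1t : 0 < 1 - t := by linarith [ht.2]
    have hR : signedRoot μ Z X t = (1 - t) * (√(1 - t) * √(S t)) := by
      have hsq : signedRoot μ Z X t ^ 2 = (1 - t) ^ 2 * ((1 - t) * S t) := by
        rw [hm.signedRoot_sq_eq hX hα hη ht₀ hmax ht, h1, hht]
        simp only [hS]
        ring
      have := congrArg Real.sqrt hsq
      rwa [Real.sqrt_sq (hm.signedRoot_pos hX hα hη ht₀ hmax h1 t ht).le,
        Real.sqrt_mul (by positivity), Real.sqrt_sq h1t.le, Real.sqrt_mul h1t.le] at this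
    have hηt := (eta_pos (hm.measurable_contribution []) hX hη (Ioo_subset_Ioc_self ht)).ne'
    rw [hm.tsum_tail_eq hX hη hgη ht, hR, mul_div_cancel_left₀ _ h1t.ne']
    simp only [hf]
    ring
  have hfrac : Tendsto (fun t => 2 * √(S t) / eta μ (X []) t) (𝓝[<] 1) (𝓝 (2 * √S₁)) := by
    have := (hSl.const_mul 2).div hηl one_ne_zero
    rwa [div_one] at this
  have hQlim : Tendsto (fun t : ℝ => ∑' k : ℕ, tail μ Z X k * t ^ k) (𝓝[<] 1) (𝓝 (-2 * m)) := by
    have := (hfl.const_mul (-2)).sub (tendsto_sqrt_one_sub.mul hfrac)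
    rw [zero_mul, sub_zero] at this
    exact this.congr' (hQ.mono fun t ht => ht.symm)
  have hsum : HasSum (fun k : ℕ => tail μ Z X k) (-2 * m) :=
    summable_of_tendsto_powerSeries (fun k => tail_nonneg _)
      (fun t ht => summable_tail (Ioo_subset_Ico_self ht)) hQlim
  -- The tail series converges at `1`, so its `√(1-t)` singularity is not directly Tauberian.
  -- Passing to tail sums divides the increment by `1-t` and produces `(1-t)^(-1/2)`.
  set T : ℕ → ℝ := fun k => ∑' j : ℕ, tail μ Z X ((j + (k + 1) : ℕ) : ℝ) with hT
  have hTid := fun t ht => one_sub_mul_tsum_tail (p := fun k : ℕ => tail μ Z X k) (t := t)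
    (fun k => tail_nonneg _) hsum.summable ht
  have hTrec : ∀ k, T k = T (k + 1) + tail μ Z X ((k + 1 : ℕ) : ℝ) := fun k => by
    have h1 := ((summable_nat_add_iff (k + 1)).2 hsum.summable).tsum_eq_zero_add
    simp only [hT]
    rw [h1, zero_add, add_comm]
    congr 1
    refine tsum_congr fun j => ?_
    congr 2; ring
  -- The analytic part contributes `f(t) - f(1) = (t-1) dslope f 1 t`, which is negligible after
  -- division by `√(1-t)`; only `2√S₁` survives.
  have hTlim : Tendsto (fun t => (1 - t) ^ (1 / 2 : ℝ) * ∑' k, T k * t ^ k) (𝓝[<] 1)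
      (𝓝 (-2 * (0 * dslope f 1 1) + 2 * √S₁)) := by
    have hdl := (analyticAt_dslope hfA).continuousAt.tendsto.mono_left
      (nhdsWithin_le_nhds (s := Iio 1))
    refine (((tendsto_sqrt_one_sub.mul hdl).const_mul (-2)).add hfrac).congr' ?_
    filter_upwards [Ioo_mem_nhdsLT (zero_lt_one' ℝ), hQ] with t ht hQt
    have h1t : 0 < 1 - t := by linarith [ht.2]
    have h2 := (hTid t ht).2
    have hft := eq_add_mul_dslope f 1 t
    rw [hsum.tsum_eq, hQt, hft, hf1] at h2
    have hs : √(1 - t) ^ 2 = 1 - t := Real.sq_sqrt h1t.le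
    have hs0 : √(1 - t) ≠ 0 := (Real.sqrt_pos.2 h1t).ne'
    rw [← Real.sqrt_eq_rpow]
    refine mul_left_cancel₀ hs0 ?_
    linear_combination (-2 * dslope f 1 t - ∑' k, T k * t ^ k) * hs - h2
  have hTanti : Antitone T := antitone_nat_of_succ_le fun k => by
    rw [hTrec k]; linarith [tail_nonneg (μ := μ) (Z := Z) (X := X) ((k + 1 : ℕ) : ℝ)]
  have hkar := tendsto_coeff_of_antitone (by norm_num) (by norm_num)
    (fun k => tsum_nonneg fun j => tail_nonneg _) hTanti (fun t ht => (hTid t ht).1) hTlim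
  rw [show (1 - 1 / 2 : ℝ) = 1 / 2 by norm_num] at hkar
  have hden := tendsto_of_tendsto_tail_sum (p := fun k : ℕ => tail μ Z X k) antitone_tail hTrec hkar
  have hc : (-2 * (0 * dslope f 1 1) + 2 * √S₁) * (Real.Gamma (1 / 2))⁻¹ / 2
      = √(-(iteratedDeriv 2 (h μ (X [])) 1) * (1 - probNonneg μ (X [])) / (8 * Real.pi)) := by
    rw [Real.Gamma_one_half_eq, ← Real.sqrt_inv, zero_mul, mul_zero, zero_add, mul_assoc,
      mul_div_cancel_left₀ _ two_ne_zero, ← Real.sqrt_mul hS1pos.le, hh2, hS₁]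
    congr 1
    field_simp
    ring
  rw [hc] at hden
  refine isEquivalent_tail (Real.sqrt_pos.2 ?_).ne' hden
  rw [hh2]
  have : 0 < -(2 * H₂ 1) := by linarith
  positivity

end IsBGWRunoffModel

end Regimes
end Runoff

theorem mainTheorem5 {Ω : Type*} [MeasurableSpace Ω] (μ : Measure Ω) [IsProbabilityMeasure μ]
    (Z : List ℕ → Ω → ℕ) (X : List ℕ → Ω → ℤ)
    (hmodel : Runoff.IsBGWRunoffModel μ (1 / 2) Z X)
    (hX : ∀ᵐ ω ∂μ, -1 ≤ X [] ω)
    (hα : Runoff.probNonneg μ (X []) < 1)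
    (hη : ∀ᶠ t in 𝓝 (1 : ℝ), Integrable (fun ω => t ^ (X [] ω + 1)) μ)
    (t₀ : ℝ) (ht₀ : t₀ ∈ Set.Ioc (0 : ℝ) 1)
    (hmax : ∀ t ∈ Set.Icc (0 : ℝ) 1, t ≠ t₀ → Runoff.h μ (X []) t < Runoff.h μ (X []) t₀) :
    (t₀ = 1 →
      variance (fun ω => (X [] ω : ℝ)) μ
          < -Runoff.mean μ (X []) * (1 - Runoff.mean μ (X [])) →
      ∀ p : ℝ, 0 < p → ∫⁻ ω, Runoff.W Z X ω ^ p ∂μ < ∞) ∧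
    (t₀ = 1 →
      variance (fun ω => (X [] ω : ℝ)) μ
          = -Runoff.mean μ (X []) * (1 - Runoff.mean μ (X [])) →
      Runoff.tail μ Z X ~[atTop] fun x : ℝ =>
        Real.sqrt (-(iteratedDeriv 2 (Runoff.h μ (X [])) 1)
          * (1 - Runoff.probNonneg μ (X [])) / (8 * Real.pi)) * x ^ (-(3 / 2) : ℝ)) ∧
    (t₀ < 1 →
      Runoff.tail μ Z X ~[atTop] fun x : ℝ =>
        Real.sqrt ((Runoff.h μ (X []) t₀ - Runoff.h μ (X []) 1)
          * (1 - Runoff.probNonneg μ (X [])) / Real.pi) * x ^ (-(1 / 2) : ℝ)) := by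
  exact ⟨fun h1 hV p hp => hmodel.subcritical hX hα hη ht₀ hmax h1 hV hp,
    fun h1 hV => hmodel.critical hX hα hη ht₀ hmax h1 hV,
    fun h1 => hmodel.supercritical hX hα hη ht₀ hmax h1⟩
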